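/- Let $M$ be a Lie group with a left invariant Riemannian metric $\langle\cdot,\cdot\rangle$, with Lie algebra $\mathfrak m$, and let $\{E_1(q),E_2(q),E_3(q)\}$ be a left invariant orthonormal frame (so $\dim M=3$) with Christoffel symbols $\nabla_{E_i(q)}E_j(q)=\sum_k\Gamma_{ij}^kE_k(q)$, where $\nabla$ is the Levi-Civita connection. Write $E_i=E_i(e)$, identify $w=\sum_i w_iE_i\in\mathfrak m$ with $(w_1,w_2,w_3)\in\mathbb R^3$, let $\times$ be the standard cross product, and put $\Gamma(x,y)=\big(\sum_{i,j}x_iy_j\Gamma_{ij}^k\big)_{k=1,2,3}$. Let $\Sigma$ be a simply connected Lorentz surface, i.e. a smooth surface with an atlas of proper null coordinates $(u,v)$: each coordinate change has Jacobian matrix $\mathrm{diag}(\alpha,\beta)$ with $\alpha\beta>0$ at every point. Let $N^e=(N_1,N_2,N_3):\Sigma\to\mathbb S^2\subseteq\mathfrak m$ be a smooth map, $K:\Sigma\to\mathbb R$ a smooth negative function, and let $\theta$ be an $\mathbb R^3$-valued one-form on $\Sigma$ (written $\theta=\mathbf a\,du+\mathbf A\,dv$ in proper null coordinates) such that, in each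 coordinate chart $(u,v)$ of the atlas, $\mathbf a=(\mathbf a_1,\mathbf a_2,\mathbf a_3)$ and $\mathbf A=(\mathbf A_1,\mathbf A_2,\mathbf A_3)$ are smooth, are linearly independent at every point, and satisfy $$\mathbf a=\frac{1}{\sqrt{-K}}\,N^e\times D_uN^e,\qquad \mathbf A=\frac{-1}{\sqrt{-K}}\,N^e\times D_vN^e,$$ where $D_uW=W_u+\Gamma(\mathbf a,W)$ and $D_vW=W_v+\Gamma(\mathbf A,W)$ for an $\mathbb R^3$-valued function $W$. Assume also the integrability condition that $$V=D_u\Big(\tfrac1{\sqrt{-K}}D_vN^e\Big)+D_v\Big(\tfrac1{\sqrt{-K}}D_uN^e\Big)$$ is parallel to $N^e$ at every point, i.e. a (possibly zero) multiple of $N^e$. Then there is a smooth immersion $\varphi:\Sigma\to M$ with the following properties. 1. In every chart $(u,v)$ of the atlas, $\varphi_u(p)=\sum_i\mathbf a_i(p)E_i(\varphi(p))$ and $\varphi_v(p)=\sum_i\mathbf A_i(p)E_i(\varphi(p))$. 2. $N^e$ is a Gauss map of $\varphi$: $N(p)=\sum_iN_i(p)E_i(\varphi(p))$ is a unit normal field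 along $\varphi$. 3. $K$ is the extrinsic curvature of $\varphi$, i.e. the determinant of the shape operator associated with $N$. 4. The second fundamental form $II=\langle-\nabla N,d\varphi\rangle$ induces the null structure of $\Sigma$: in every chart of the atlas, $II=2\mathbf f\,du\,dv$ with $\mathbf f$ nowhere zero. Moreover, at each point $\mathbf f>0$ (that is, $N$ is compatible with the proper null coordinates) if and only if $\det(N^e,\mathbf a,\mathbf A)>0$. The immersion is unique up to left translations: a map $\psi:\Sigma\to M$ is a smooth immersion with properties 1–4 if and only if there is $c\in M$ with $\psi(p)=c\,\varphi(p)$ for all $p\in\Sigma$. -/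

import Mathlib

open Bundle Manifold Matrix
open scoped ContDiff

noncomputable section

/-! ### Riemannian Lie groups -/

section LieGroupGeometry

variable {E : Type*} [NormedAddCommGroup E] [NormedSpace ℝ E]
  {M : Type*} [TopologicalSpace M] [ChartedSpace E M] [Group M] [LieGroup 𝓘(ℝ, E) ∞ M]

/-- A left invariant Riemannian metric on a Lie group `M`: a smooth Riemannian metric for which
every left translation `h ↦ a * h` is an isometry. -/
structure LeftInvariantMetric (E M : Type*) [NormedAddCommGroup E] [NormedSpace ℝ E]
    [TopologicalSpace M] [ChartedSpace E M] [Group M] [LieGroup 𝓘(ℝ, E) ∞ M] extends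
    ContMDiffRiemannianMetric 𝓘(ℝ, E) ∞ E (TangentSpace 𝓘(ℝ, E) : M → Type _) where
  inner_translate : ∀ (a h : M) (v w : TangentSpace 𝓘(ℝ, E) h),
    inner (a * h) (mfderiv 𝓘(ℝ, E) 𝓘(ℝ, E) (fun x : M ↦ a * x) h v)
      (mfderiv 𝓘(ℝ, E) 𝓘(ℝ, E) (fun x : M ↦ a * x) h w) = inner h v w

/-- A basis of the Lie algebra is orthonormal for the metric at the identity. -/
def LeftInvariantMetric.IsOrthonormal (g : LeftInvariantMetric E M)
    (b : Module.Basis (Fin 3) ℝ (GroupLieAlgebra 𝓘(ℝ, E) M)) : Prop :=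
  ∀ i j, g.inner 1 (b i) (b j) = if i = j then 1 else 0

/-- The left invariant frame `E_i(q) = d(L_q)(E_i)` determined by a basis `E_i` of the Lie
algebra. -/
def leftFrame (b : Module.Basis (Fin 3) ℝ (GroupLieAlgebra 𝓘(ℝ, E) M)) (i : Fin 3) (q : M) :
    TangentSpace 𝓘(ℝ, E) q :=
  mulInvariantVectorField (b i) q

/-- The structure constants `⟨[E_i, E_j], E_k⟩` of an orthonormal basis of the Lie algebra. -/
def structureConstant (g : LeftInvariantMetric E M)
    (b : Module.Basis (Fin 3) ℝ (GroupLieAlgebra 𝓘(ℝ, E) M)) (i j k : Fin 3) : ℝ :=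
  g.inner 1 ⁅b i, b j⁆ (b k)

/-- The Christoffel symbols `Γ_{ij}^k = ⟨∇_{E_i} E_j, E_k⟩` of the Levi-Civita connection `∇` in a
left invariant orthonormal frame, given by Koszul's formula
`2⟨∇_X Y, Z⟩ = ⟨[X, Y], Z⟩ - ⟨[Y, Z], X⟩ + ⟨[Z, X], Y⟩` (the metric coefficients are constant).
See `inner_leviCivita_eq_christoffel` for the agreement with `∇`. -/
def christoffel (g : LeftInvariantMetric E M)
    (b : Module.Basis (Fin 3) ℝ (GroupLieAlgebra 𝓘(ℝ, E) M)) (i j k : Fin 3) : ℝ :=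
  (structureConstant g b i j k - structureConstant g b j k i + structureConstant g b k i j) / 2

theorem LeftInvariantMetric.inner_leftFrame (g : LeftInvariantMetric E M)
    (v w : GroupLieAlgebra 𝓘(ℝ, E) M) (q : M) :
    g.inner q (mulInvariantVectorField v q) (mulInvariantVectorField w q) = g.inner 1 v w := by
  have hq (r : M) (hr : r = q) (x y : E) : g.inner q x y = g.inner r x y := by
    subst hr; rfl
  exact (hq _ (mul_one q) _ _).trans (g.inner_translate q 1 v w)

/-- If `∇` is torsion free and compatible with a left invariant metric, then
`⟨∇_{E_i} E_j, E_k⟩ = Γ_{ij}^k` at every point, for every orthonormal left invariant frame. -/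
theorem inner_leviCivita_eq_christoffel [FiniteDimensional ℝ E] 
    (g : LeftInvariantMetric E M)
    (b : Module.Basis (Fin 3) ℝ (GroupLieAlgebra 𝓘(ℝ, E) M)) 
    (cov : CovariantDerivative 𝓘(ℝ, E) E (TangentSpace 𝓘(ℝ, E) : M → Type _))
    (htor : ∀ (X Y : Π q : M, TangentSpace 𝓘(ℝ, E) q) (q : M),
      MDiffAt (T% X) q → MDiffAt (T% Y) q →
      cov Y q (X q) - cov X q (Y q) = VectorField.mlieBracket 𝓘(ℝ, E) X Y q)
    (hmet : ∀ (X Y Z : Π q : M, TangentSpace 𝓘(ℝ, E) q) (q : M),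
      MDiffAt (T% Y) q → MDiffAt (T% Z) q →
      mvfderiv 𝓘(ℝ, E) (fun x ↦ g.inner x (Y x) (Z x)) q (X q) =
        g.inner q (cov Y q (X q)) (Z q) + g.inner q (Y q) (cov Z q (X q)))
    (i j k : Fin 3) (q : M) :
    g.inner q (cov (leftFrame b j) q (leftFrame b i q)) (leftFrame b k q) =
      christoffel g b i j k := by
  have : LieGroup 𝓘(ℝ, E) (minSmoothness ℝ 3) M := by
    rw [minSmoothness_of_isRCLikeNormedField]; infer_instance
  have : CompleteSpace E := FiniteDimensional.complete ℝ E
  have hd (i : Fin 3) : MDiffAt (T% (leftFrame b i)) q :=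
    mdifferentiableAt_mulInvariantVectorField (b i)
  have hc (i j k : Fin 3) : g.inner q (cov (leftFrame b j) q (leftFrame b i q)) (leftFrame b k q)
      + g.inner q (leftFrame b j q) (cov (leftFrame b k) q (leftFrame b i q)) = 0 := by
    rw [← hmet _ _ _ q (hd j) (hd k)]
    have : (fun x ↦ g.inner x (leftFrame b j x) (leftFrame b k x)) =
        fun _ ↦ g.inner 1 (b j) (b k) := by
      funext x
      exact g.inner_leftFrame _ _ _
    rw [this, mvfderiv_const]
    rfl
  have ht (i j k : Fin 3) : g.inner q (cov (leftFrame b j) q (leftFrame b i q)) (leftFrame b k q)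
      - g.inner q (cov (leftFrame b i) q (leftFrame b j q)) (leftFrame b k q)
      = structureConstant g b i j k := by
    have := htor (leftFrame b i) (leftFrame b j) q (hd i) (hd j)
    have h2 : VectorField.mlieBracket 𝓘(ℝ, E) (leftFrame b i) (leftFrame b j) q =
      mulInvariantVectorField ⁅b i, b j⁆ q :=
      (congrFun (mulInvariantVector_mlieBracket (b i) (b j)) q).symm
    rw [h2] at this
    rw [structureConstant, ← g.inner_leftFrame _ _ q, ← this]
    simp [leftFrame]
  have hs := g.symm q
  have h1 := hc i j k
  have h2 := hc j k i
  have h3 := hc k i j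
  rw [hs (leftFrame b j q)] at h1
  rw [hs (leftFrame b k q)] at h2
  rw [hs (leftFrame b i q)] at h3
  rw [christoffel, ← ht i j k, ← ht j k i, ← ht k i j]
  linarith

end LieGroupGeometry

/-! ### Lorentz surfaces -/

/-- A Lorentz surface, given by an atlas of proper null coordinates `(u, v)`: a smooth surface whose
coordinate changes preserve the conformal class of `du dv` and the orientation. At each point, the
Jacobian matrix of a coordinate change is `diag(α, β)` with `α β > 0`. -/
class LorentzSurface (S : Type*) [TopologicalSpace S] [ChartedSpace (ℝ × ℝ) S] : Prop extends
    IsManifold 𝓘(ℝ, ℝ × ℝ) ∞ S where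
  proper_null : ∀ e ∈ atlas (ℝ × ℝ) S, ∀ e' ∈ atlas (ℝ × ℝ) S, ∀ x ∈ (e.symm ≫ₕ e').source,
    ∃ α β : ℝ, 0 < α * β ∧ fderiv ℝ (e' ∘ e.symm) x (1, 0) = (α, 0) ∧
      fderiv ℝ (e' ∘ e.symm) x (0, 1) = (0, β)

section Surface

variable {S : Type*} [TopologicalSpace S] [ChartedSpace (ℝ × ℝ) S]

/-- The coordinate vector field `∂_u` of a chart `e = (u, v)`: the vector with `de(∂_u) = (1, 0)`. -/
def coordU (e : OpenPartialHomeomorph S (ℝ × ℝ)) (p : S) : TangentSpace 𝓘(ℝ, ℝ × ℝ) p :=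
  VectorField.mpullback 𝓘(ℝ, ℝ × ℝ) 𝓘(ℝ, ℝ × ℝ) e (fun _ ↦ ((1 : ℝ), (0 : ℝ))) p

/-- The coordinate vector field `∂_v` of a chart `e = (u, v)`: the vector with `de(∂_v) = (0, 1)`. -/
def coordV (e : OpenPartialHomeomorph S (ℝ × ℝ)) (p : S) : TangentSpace 𝓘(ℝ, ℝ × ℝ) p :=
  VectorField.mpullback 𝓘(ℝ, ℝ × ℝ) 𝓘(ℝ, ℝ × ℝ) e (fun _ ↦ ((0 : ℝ), (1 : ℝ))) p

/-- The bilinear map `(x, y) ↦ (∑_{i,j} x_i y_j Γ_{ij}^k)_k`, i.e. `∇_x y` for left invariant vector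
fields `x`, `y` written in the frame. -/
def connectionTerm (Γ : Fin 3 → Fin 3 → Fin 3 → ℝ) (x y : Fin 3 → ℝ) : Fin 3 → ℝ :=
  fun k ↦ ∑ i, ∑ j, x i * y j * Γ i j k

/-- Covariant derivative in the frame: for an `ℝ³`-valued one-form `θ` and an `ℝ³`-valued function
`W` on `S`, the vector with components `X(W_k) + ∑_{i,j} θ_i(X) W_j Γ_{ij}^k`. When `θ` is the
left translate `φ⁻¹ dφ`, these are the components of `∇_{dφ(X)} W` along `φ`. -/
def frameDeriv (Γ : Fin 3 → Fin 3 → Fin 3 → ℝ)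
    (θ : Π p : S, TangentSpace 𝓘(ℝ, ℝ × ℝ) p →L[ℝ] (Fin 3 → ℝ)) (W : S → Fin 3 → ℝ) (p : S)
    (X : TangentSpace 𝓘(ℝ, ℝ × ℝ) p) : Fin 3 → ℝ :=
  mvfderiv 𝓘(ℝ, ℝ × ℝ) W p X + connectionTerm Γ (θ p X) (W p)

/-- The two systems of equations at a point `p` of a null chart `e = (u, v)`, for the functions
`a = θ(∂_u)` and `A = θ(∂_v)`:
`a = (1/√-K) N × (N_u + Γ(a, N))` and `A = (-1/√-K) N × (N_v + Γ(A, N))`. -/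
def SolvesNullSystems (Γ : Fin 3 → Fin 3 → Fin 3 → ℝ) (N : S → Fin 3 → ℝ) (K : S → ℝ)
    (θ : Π p : S, TangentSpace 𝓘(ℝ, ℝ × ℝ) p →L[ℝ] (Fin 3 → ℝ))
    (e : OpenPartialHomeomorph S (ℝ × ℝ)) (p : S) : Prop :=
  θ p (coordU e p) = (1 / √(-K p)) • (N p ⨯₃ frameDeriv Γ θ N p (coordU e p)) ∧
  θ p (coordV e p) = (-1 / √(-K p)) • (N p ⨯₃ frameDeriv Γ θ N p (coordV e p))

/-- The vector `V`, the left translate to the identity of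
`∇_{∂_u}((1/√-K) ∇_{∂_v} N) + ∇_{∂_v}((1/√-K) ∇_{∂_u} N)`. -/
def integrabilityVector (Γ : Fin 3 → Fin 3 → Fin 3 → ℝ) (N : S → Fin 3 → ℝ) (K : S → ℝ)
    (θ : Π p : S, TangentSpace 𝓘(ℝ, ℝ × ℝ) p →L[ℝ] (Fin 3 → ℝ))
    (e : OpenPartialHomeomorph S (ℝ × ℝ)) (p : S) : Fin 3 → ℝ :=
  frameDeriv Γ θ (fun q ↦ (1 / √(-K q)) • frameDeriv Γ θ N q (coordV e q)) p (coordU e p) +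
  frameDeriv Γ θ (fun q ↦ (1 / √(-K q)) • frameDeriv Γ θ N q (coordU e q)) p (coordV e p)

end Surface

/-! ### Geometry of a surface in a Riemannian Lie group -/

section Immersion

variable {E : Type*} [NormedAddCommGroup E] [NormedSpace ℝ E]
  {M : Type*} [TopologicalSpace M] [ChartedSpace E M] [Group M] [LieGroup 𝓘(ℝ, E) ∞ M]
  {S : Type*} [TopologicalSpace S] [ChartedSpace (ℝ × ℝ) S]

/-- The tangent vector `∑_k w_k E_k(q)`. -/
def frameVector (b : Module.Basis (Fin 3) ℝ (GroupLieAlgebra 𝓘(ℝ, E) M)) (w : Fin 3 → ℝ) (q : M) :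
    TangentSpace 𝓘(ℝ, E) q :=
  ∑ k, w k • leftFrame b k q

/-- The components `⟨dφ(X), E_i(φ(p))⟩` of `φ(p)⁻¹ dφ(X)`, as an `ℝ³`-valued one-form on `S`. -/
def leftTranslatedDeriv (g : LeftInvariantMetric E M)
    (b : Module.Basis (Fin 3) ℝ (GroupLieAlgebra 𝓘(ℝ, E) M)) (φ : S → M) (p : S) :
    TangentSpace 𝓘(ℝ, ℝ × ℝ) p →L[ℝ] (Fin 3 → ℝ) :=
  ContinuousLinearMap.pi fun i ↦ (g.inner (φ p) (leftFrame b i (φ p))).comp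
    (mfderiv 𝓘(ℝ, ℝ × ℝ) 𝓘(ℝ, E) φ p)

/-- The Levi-Civita covariant derivative `∇_{dφ(X)} W` of the vector field
`W(p) = ∑_k W_k(p) E_k(φ(p))` along `φ`. -/
def covDerivAlong (g : LeftInvariantMetric E M)
    (b : Module.Basis (Fin 3) ℝ (GroupLieAlgebra 𝓘(ℝ, E) M)) (φ : S → M) (W : S → Fin 3 → ℝ)
    (p : S) (X : TangentSpace 𝓘(ℝ, ℝ × ℝ) p) : TangentSpace 𝓘(ℝ, E) (φ p) :=
  frameVector b (frameDeriv (christoffel g b) (leftTranslatedDeriv g b φ) W p X) (φ p)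

/-- The second fundamental form `II(X, Y) = ⟨-∇_{dφ(X)} N, dφ(Y)⟩`. -/
def secondFundamentalForm (g : LeftInvariantMetric E M)
    (b : Module.Basis (Fin 3) ℝ (GroupLieAlgebra 𝓘(ℝ, E) M)) (φ : S → M) (N : S → Fin 3 → ℝ)
    (p : S) (X Y : TangentSpace 𝓘(ℝ, ℝ × ℝ) p) : ℝ :=
  g.inner (φ p) (-covDerivAlong g b φ N p X) (mfderiv 𝓘(ℝ, ℝ × ℝ) 𝓘(ℝ, E) φ p Y)

/-- `φ` is a smooth immersion: it is smooth and its differential is injective at every point. -/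
def IsSmoothImmersion (E : Type*) [NormedAddCommGroup E] [NormedSpace ℝ E] {M : Type*}
    [TopologicalSpace M] [ChartedSpace E M] (φ : S → M) : Prop :=
  ContMDiff 𝓘(ℝ, ℝ × ℝ) 𝓘(ℝ, E) ∞ φ ∧
    ∀ p, Function.Injective (mfderiv 𝓘(ℝ, ℝ × ℝ) 𝓘(ℝ, E) φ p)

/-- `N` gives the components of a unit normal field along `φ`, i.e. it is the left translate to the
identity of a unit normal field. -/
def IsGaussMap (g : LeftInvariantMetric E M)
    (b : Module.Basis (Fin 3) ℝ (GroupLieAlgebra 𝓘(ℝ, E) M)) (φ : S → M) (N : S → Fin 3 → ℝ) :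
    Prop :=
  ∀ p, g.inner (φ p) (frameVector b (N p) (φ p)) (frameVector b (N p) (φ p)) = 1 ∧
    ∀ X, g.inner (φ p) (frameVector b (N p) (φ p)) (mfderiv 𝓘(ℝ, ℝ × ℝ) 𝓘(ℝ, E) φ p X) = 0

/-- `K` is the extrinsic curvature of `φ` with unit normal `N`: at every point, `K` is the
determinant of the shape operator `T`, where `dφ(T X) = -∇_{dφ(X)} N`. -/
def IsExtrinsicCurvature (g : LeftInvariantMetric E M)
    (b : Module.Basis (Fin 3) ℝ (GroupLieAlgebra 𝓘(ℝ, E) M)) (φ : S → M) (N : S → Fin 3 → ℝ)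
    (K : S → ℝ) : Prop :=
  ∀ p, ∃ T : TangentSpace 𝓘(ℝ, ℝ × ℝ) p →ₗ[ℝ] TangentSpace 𝓘(ℝ, ℝ × ℝ) p,
    (∀ X, mfderiv 𝓘(ℝ, ℝ × ℝ) 𝓘(ℝ, E) φ p (T X) = -covDerivAlong g b φ N p X) ∧
      LinearMap.det T = K p

/-- `φ` is an immersion with Gauss map `N` and extrinsic curvature `K`, with
`φ_u = ∑ a_i E_i(φ)` and `φ_v = ∑ A_i E_i(φ)` for `a = θ(∂_u)`, `A = θ(∂_v)`, whose second
fundamental form induces the structure of `S`: in every null chart it is `2 f du dv`, with `f`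
nowhere zero, and `f > 0` exactly where `(N, a, A)` is positively oriented. -/
structure RealizesData (g : LeftInvariantMetric E M)
    (b : Module.Basis (Fin 3) ℝ (GroupLieAlgebra 𝓘(ℝ, E) M)) (N : S → Fin 3 → ℝ) (K : S → ℝ)
    (θ : Π p : S, TangentSpace 𝓘(ℝ, ℝ × ℝ) p →L[ℝ] (Fin 3 → ℝ)) (φ : S → M) : Prop where
  immersion : IsSmoothImmersion E φ
  gaussMap : IsGaussMap g b φ N
  curvature : IsExtrinsicCurvature g b φ N K
  deriv_eq : ∀ e ∈ atlas (ℝ × ℝ) S, ∀ p ∈ e.source,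
    mfderiv 𝓘(ℝ, ℝ × ℝ) 𝓘(ℝ, E) φ p (coordU e p) = frameVector b (θ p (coordU e p)) (φ p) ∧
    mfderiv 𝓘(ℝ, ℝ × ℝ) 𝓘(ℝ, E) φ p (coordV e p) = frameVector b (θ p (coordV e p)) (φ p)
  null_structure : ∀ e ∈ atlas (ℝ × ℝ) S, ∀ p ∈ e.source,
    secondFundamentalForm g b φ N p (coordU e p) (coordU e p) = 0 ∧
    secondFundamentalForm g b φ N p (coordV e p) (coordV e p) = 0 ∧
    secondFundamentalForm g b φ N p (coordU e p) (coordV e p) =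
      secondFundamentalForm g b φ N p (coordV e p) (coordU e p) ∧
    secondFundamentalForm g b φ N p (coordU e p) (coordV e p) ≠ 0
  compatible : ∀ e ∈ atlas (ℝ × ℝ) S, ∀ p ∈ e.source,
    (0 < secondFundamentalForm g b φ N p (coordU e p) (coordV e p) ↔
      0 < N p ⬝ᵥ (θ p (coordU e p) ⨯₃ θ p (coordV e p)))

end Immersion

end

noncomputable section

/-! ### A local Frobenius theorem -/

section Frobenius

open Set Metric Filter Topology
open scoped NNReal

variable {B F : Type*} [NormedAddCommGroup B] [NormedSpace ℝ B] [NormedAddCommGroup F]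
  [NormedSpace ℝ F]

/-! A map `φ` with `φ⁻¹ dφ = θ` exists on a simply connected surface once `θ` satisfies the
Maurer-Cartan equation, and it is then unique up to left translation. So the theorem splits into an
equation for `θ` and pointwise algebra.

The equation. Since `Γ` is torsion free, Maurer-Cartan reads `D_v a = D_u A`. Put `ρ = 1/√-K`, so
that `a = N × ρ D_u N` and `A = -N × ρ D_v N`. Since `Γ` is metric, `D` is a derivation of the cross
product. Expanding both sides, the terms `D_v N × ρ D_u N` and `-D_u N × ρ D_v N` agree, and the
difference of the others is `N × V`, which vanishes because `V` is parallel to `N`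
(`frameDeriv_swap`, `maurerCartanOn_coordForm`).

The primitive. In the chart of the group at the identity, `φ⁻¹ dφ = θ` becomes a total differential
equation whose integrability condition is Maurer-Cartan (`pfaffian_integrable`). Local Frobenius
(`exists_solution_totalDiffEq`) solves it. Local solutions differ by constant left translations
(`IsPrimitiveAt.eventually_eq`), hence define a covering with the group as discrete fibre, and a
section of it glues them (`exists_glue_of_left_translation`).

The algebra. On the plane orthogonal to `N`, `N ×` squares to `-1`, so the systems invert to `D_u N
= -√-K N × a` and `D_v N = √-K N × A`. Then `II` vanishes on `(∂_u, ∂_u)` and `(∂_v, ∂_v)`, its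
mixed value is `√-K det(N, a, A)`, and the shape operator has determinant `K`
(`realizesData_of_isPrimitiveAt`). -/

theorem norm_sub_sub_fderiv_le {Z W : Type*} [NormedAddCommGroup Z] [NormedSpace ℝ Z]
    [NormedAddCommGroup W] [NormedSpace ℝ W] {f : Z → W} {s : Set Z} {C : ℝ≥0}
    (hs : Convex ℝ s) (hf : ∀ z ∈ s, DifferentiableAt ℝ f z)
    (hC : LipschitzOnWith C (fderiv ℝ f) s) {x y : Z} (hx : x ∈ s) (hy : y ∈ s) :
    ‖f y - f x - fderiv ℝ f x (y - x)‖ ≤ C * ‖y - x‖ * ‖y - x‖ := by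
  have hss : segment ℝ x y ⊆ s := hs.segment_subset hx hy
  refine (convex_segment x y).norm_image_sub_le_of_norm_hasFDerivWithin_le'
    (f' := fderiv ℝ f) (fun z hz ↦ (hf z (hss hz)).hasFDerivAt.hasFDerivWithinAt)
    (fun z hz ↦ ?_) (left_mem_segment ℝ x y) (right_mem_segment ℝ x y)
  refine (hC.norm_sub_le (hss hz) hx).trans ?_
  gcongr
  obtain ⟨a, b, ha, hb, hab, rfl⟩ := hz
  have : a • x + b • y - x = b • (y - x) := by
    rw [← eq_sub_iff_add_eq] at hab; subst hab; module
  rw [this, norm_smul, Real.norm_of_nonneg hb]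
  exact mul_le_of_le_one_left (norm_nonneg _) (by linarith)

/-- Bounds for a total differential equation `dx = Ω(s, x)` on a convex set. -/
structure TotalDiffEqBounds (Ω : B × F → B →L[ℝ] F) (s : Set (B × F)) (C M₁ M₂ : ℝ≥0) : Prop where
  diff : ∀ z ∈ s, DifferentiableAt ℝ Ω z
  norm_le : ∀ z ∈ s, ‖Ω z‖ ≤ C
  lip : LipschitzOnWith M₁ Ω s
  lip_fderiv : LipschitzOnWith M₂ (fderiv ℝ Ω) s

theorem exists_totalDiffEqBounds {Ω : B × F → B →L[ℝ] F} {U : Set (B × F)} (hU : IsOpen U)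
    (hΩ : ContDiffOn ℝ ∞ Ω U) {z₀ : B × F} (hz : z₀ ∈ U) :
    ∃ ρ > 0, ∃ C M₁ M₂ : ℝ≥0, closedBall z₀ ρ ⊆ U ∧
      TotalDiffEqBounds Ω (closedBall z₀ ρ) C M₁ M₂ := by
  have h1 : ContDiffAt ℝ ∞ Ω z₀ := hΩ.contDiffAt (hU.mem_nhds hz)
  have h2 : ContDiffAt ℝ 1 (fderiv ℝ Ω) z₀ :=
    h1.fderiv_right (m := 1) (by norm_num; exact ENat.LEInfty.out)
  obtain ⟨M₁, t₁, ht₁, hM₁⟩ := (h1.of_le (m := 1) (by exact mod_cast le_top)).exists_lipschitzOnWith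
  obtain ⟨M₂, t₂, ht₂, hM₂⟩ := h2.exists_lipschitzOnWith
  have h3 : ∀ᶠ z in 𝓝 z₀, ‖Ω z‖ ≤ ‖Ω z₀‖ + 1 :=
    (h1.continuousAt.norm).eventually_le_const (by simp) |>.mono fun _ h ↦ h
  obtain ⟨ρ, hρ, hsub⟩ := nhds_basis_closedBall.mem_iff.1
    (inter_mem (inter_mem (hU.mem_nhds hz) h3) (inter_mem ht₁ ht₂))
  refine ⟨ρ, hρ, ⟨‖Ω z₀‖ + 1, by positivity⟩, M₁, M₂, fun z h ↦ (hsub h).1.1, fun z h ↦ ?_,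
    fun z h ↦ (hsub h).1.2, hM₁.mono fun z h ↦ (hsub h).2.1, hM₂.mono fun z h ↦ (hsub h).2.2⟩
  exact (hΩ.contDiffAt (hU.mem_nhds (hsub h).1.1)).differentiableAt (by simp)

variable {Ω : B × F → B →L[ℝ] F} {s₀ : B} {y₀ : F} {ρ : ℝ} {C M₁ M₂ : ℝ≥0}

theorem TotalDiffEqBounds.lipschitzOnWith_ray
    (h : TotalDiffEqBounds Ω (closedBall (s₀, y₀) ρ) C M₁ M₂) {k : B} (hk : ‖k‖ ≤ ρ) {t : ℝ}
    (ht : t ∈ Icc (0 : ℝ) 1) :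
    LipschitzOnWith (M₁ * ‖k‖₊) (fun y ↦ Ω (s₀ + t • k, y) k) (closedBall y₀ ρ) := by
  have hmem : ∀ y ∈ closedBall y₀ ρ, (s₀ + t • k, y) ∈ closedBall (s₀, y₀) ρ := by
    intro y hy
    rw [← closedBall_prod_same]
    refine ⟨?_, hy⟩
    simp only [mem_closedBall, dist_self_add_left, norm_smul, Real.norm_of_nonneg ht.1]
    exact (mul_le_of_le_one_left (norm_nonneg _) ht.2).trans hk
  refine LipschitzOnWith.of_dist_le_mul fun x hx y hy ↦ ?_
  have h1 := h.lip.dist_le_mul _ (hmem x hx) _ (hmem y hy)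
  rw [dist_eq_norm, ← _root_.sub_apply]
  refine (ContinuousLinearMap.le_opNorm _ _).trans ?_
  rw [← dist_eq_norm]
  have h2 : dist (s₀ + t • k, x) (s₀ + t • k, y) = dist x y := by simp [Prod.dist_eq]
  rw [h2] at h1
  push_cast
  calc _ ≤ M₁ * dist x y * ‖k‖ := by gcongr
    _ = _ := by ring

/-- The time interval is fixed to `[0, 1]`. The speed along the ray is at most `C * ‖k‖`, so a small
`k` takes the place of a short time in Picard-Lindelöf. -/
theorem TotalDiffEqBounds.exists_ray_solution [CompleteSpace F]
    (h : TotalDiffEqBounds Ω (closedBall (s₀, y₀) ρ) C M₁ M₂) {k : B} (hk : ‖k‖ ≤ ρ)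
    {r : ℝ≥0} (hrρ : r ≤ ρ) (hkr : C * ‖k‖ ≤ r) :
    ∃ α : ℝ → F, α 0 = y₀ ∧ (∀ t ∈ Icc (0 : ℝ) 1, α t ∈ closedBall y₀ r) ∧
      ∀ t ∈ Icc (0 : ℝ) 1, HasDerivWithinAt α (Ω (s₀ + t • k, α t) k) (Icc 0 1) t := by
  have hray : ∀ t ∈ Icc (0 : ℝ) 1, s₀ + t • k ∈ closedBall s₀ ρ := by
    intro t ht
    simp only [mem_closedBall, dist_self_add_left, norm_smul, Real.norm_of_nonneg ht.1]
    exact (mul_le_of_le_one_left (norm_nonneg _) ht.2).trans hk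
  have hmem : ∀ t ∈ Icc (0 : ℝ) 1, ∀ y ∈ closedBall y₀ r,
      (s₀ + t • k, y) ∈ closedBall (s₀, y₀) ρ := by
    intro t ht y hy
    rw [← closedBall_prod_same]
    exact ⟨hray t ht, closedBall_subset_closedBall hrρ hy⟩
  have hPL : IsPicardLindelof (fun t y ↦ Ω (s₀ + t • k, y) k) (tmin := 0) (tmax := 1)
      ⟨0, by simp⟩ y₀ r 0 (C * ‖k‖₊) (M₁ * ‖k‖₊) := by
    refine ⟨fun t ht ↦ (h.lipschitzOnWith_ray hk ht).mono (closedBall_subset_closedBall hrρ),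
      fun x hx t ht ↦ ?_, fun t ht x hx ↦ ?_, ?_⟩
    · have h1 : ContinuousAt (fun t : ℝ ↦ Ω (s₀ + t • k, x)) t :=
        ContinuousAt.comp (f := fun t : ℝ ↦ (s₀ + t • k, x))
          (h.diff _ (hmem t ht x hx)).continuousAt (by fun_prop)
      exact (h1.clm_apply continuousAt_const).continuousWithinAt
    · refine (ContinuousLinearMap.le_opNorm _ _).trans ?_
      push_cast
      gcongr
      exact h.norm_le _ (hmem t ht x hx)
    · simpa using hkr
  -- The Picard fixed point itself is kept, because its function space also confines the solution to
  -- the ball of radius `r`.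
  obtain ⟨α, hα⟩ := ODE.FunSpace.exists_isFixedPt_next hPL (x := y₀) (by simp)
  refine ⟨α.compProj, ?_, fun t ht ↦ ?_, fun t ht ↦ ?_⟩
  · have := ODE.FunSpace.compProj_val (α := α) (t := ⟨0, by simp⟩)
    rw [this, ← hα, ODE.FunSpace.next_apply₀]
  · exact α.compProj_mem_closedBall hPL.mul_max_le
  · apply ODE.hasDerivWithinAt_picard_Icc (t₀ := (0:ℝ)) (by simp) hPL.continuousOn_uncurry
      α.continuous_compProj.continuousOn (fun _ ht' ↦ α.compProj_mem_closedBall hPL.mul_max_le)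
      y₀ ht |>.congr_of_mem _ ht
    intro t' ht'
    rw [ODE.FunSpace.compProj_of_mem ht', ← hα, ODE.FunSpace.next_apply, hα]

/-- Two solutions of `dx = Ω(s, x)` with the same value at a point agree near it. -/
theorem eventuallyEq_of_hasFDerivAt {Ω : B × F → B →L[ℝ] F} {U : Set (B × F)} (hU : IsOpen U)
    (hΩ : ContDiffOn ℝ ∞ Ω U) {s₀ : B} {x₁ x₂ : B → F} (h₀ : (s₀, x₁ s₀) ∈ U)
    (h₁ : ∀ᶠ s in 𝓝 s₀, HasFDerivAt x₁ (Ω (s, x₁ s)) s)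
    (h₂ : ∀ᶠ s in 𝓝 s₀, HasFDerivAt x₂ (Ω (s, x₂ s)) s) (h : x₁ s₀ = x₂ s₀) :
    x₁ =ᶠ[𝓝 s₀] x₂ := by
  obtain ⟨ρ, hρ, C, M₁, M₂, -, hb⟩ := exists_totalDiffEqBounds hU hΩ h₀
  have c₁ : ∀ᶠ s in 𝓝 s₀, x₁ s ∈ closedBall (x₁ s₀) ρ :=
    h₁.self_of_nhds.continuousAt (closedBall_mem_nhds _ hρ)
  have c₂ : ∀ᶠ s in 𝓝 s₀, x₂ s ∈ closedBall (x₁ s₀) ρ := by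
    rw [h]
    exact h₂.self_of_nhds.continuousAt (closedBall_mem_nhds _ hρ)
  obtain ⟨δ, hδ, hball⟩ := eventually_nhds_iff_ball.1 ((h₁.and h₂).and (c₁.and c₂))
  filter_upwards [ball_mem_nhds s₀ (lt_min hδ hρ)] with s hs
  -- Restricted to the ray from `s₀` to `s₀ + k`, both solutions satisfy one ODE with a Lipschitz
  -- right-hand side and start at the same value. Uniqueness is read off at time 1.
  obtain ⟨k, rfl⟩ : ∃ k, s = s₀ + k := ⟨s - s₀, by abel⟩
  have hk : ‖k‖ < min δ ρ := by simpa using hs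
  have hray : ∀ t ∈ Icc (0 : ℝ) 1, s₀ + t • k ∈ ball s₀ δ := by
    intro t ht
    simp only [mem_ball, dist_self_add_left, norm_smul, Real.norm_of_nonneg ht.1]
    exact (mul_le_of_le_one_left (norm_nonneg _) ht.2).trans_lt (hk.trans_le (min_le_left _ _))
  have hd : ∀ x : B → F, (∀ s ∈ ball s₀ δ, HasFDerivAt x (Ω (s, x s)) s) → ∀ t ∈ Icc (0 : ℝ) 1,
      HasDerivAt (fun t : ℝ ↦ x (s₀ + t • k)) (Ω (s₀ + t • k, x (s₀ + t • k)) k) t := by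
    intro x hx t ht
    have := ((hasDerivAt_id t).smul_const k).const_add s₀
    rw [one_smul] at this
    exact (hx _ (hray t ht)).comp_hasDerivAt t this
  have d₁ := hd x₁ fun s hs ↦ (hball s hs).1.1
  have d₂ := hd x₂ fun s hs ↦ (hball s hs).1.2
  have := ODE_solution_unique_of_mem_Icc_right (a := 0) (b := 1)
    (v := fun t y ↦ Ω (s₀ + t • k, y) k) (s := fun _ ↦ closedBall (x₁ s₀) ρ)
    (fun t ht ↦ hb.lipschitzOnWith_ray (hk.le.trans (min_le_right _ _)) ⟨ht.1, ht.2.le⟩)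
    (fun t ht ↦ (d₁ t ht).continuousAt.continuousWithinAt)
    (fun t ht ↦ (d₁ t ⟨ht.1, ht.2.le⟩).hasDerivWithinAt)
    (fun t ht ↦ (hball _ (hray t ⟨ht.1, ht.2.le⟩)).2.1)
    (fun t ht ↦ (d₂ t ht).continuousAt.continuousWithinAt)
    (fun t ht ↦ (d₂ t ⟨ht.1, ht.2.le⟩).hasDerivWithinAt)
    (fun t ht ↦ (hball _ (hray t ⟨ht.1, ht.2.le⟩)).2.2)
    (by simpa using h) (right_mem_Icc.2 zero_le_one)
  simpa using this

/-- A solution of `dx = Ω(s, x)` with smooth `Ω` is smooth. -/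
theorem contDiffOn_of_hasFDerivAt {Ω : B × F → B →L[ℝ] F} {U : Set (B × F)}
    (hΩ : ContDiffOn ℝ ∞ Ω U) {V : Set B} (hV : IsOpen V) {x : B → F}
    (hx : ∀ s ∈ V, (s, x s) ∈ U ∧ HasFDerivAt x (Ω (s, x s)) s) : ContDiffOn ℝ ∞ x V := by
  rw [contDiffOn_infty]
  intro n
  induction n with
  | zero => exact contDiffOn_zero.2 fun s hs ↦ (hx s hs).2.continuousAt.continuousWithinAt
  | succ n ih =>
    push_cast
    rw [contDiffOn_succ_iff_fderiv_of_isOpen hV]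
    refine ⟨fun s hs ↦ (hx s hs).2.differentiableAt.differentiableWithinAt, by simp, ?_⟩
    -- Bootstrap: the derivative `Ω (s, x s)` is as smooth as `x`, so `x` gains one order.
    refine ContDiffOn.congr (f := fun s ↦ Ω (s, x s)) ?_ fun s hs ↦ (hx s hs).2.fderiv
    exact (hΩ.of_le (by exact mod_cast le_top)).comp (contDiffOn_id.prodMk ih)
      fun s hs ↦ (hx s hs).1

/-- Along a ray, the solution of `dx = Ω(s, x)` in the direction `k + h` is approximated to second
order in `h` by the one in the direction `k`, if `Ω` satisfies the integrability condition. -/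
theorem TotalDiffEqBounds.norm_ray_sub_le
    (hb : TotalDiffEqBounds Ω (closedBall (s₀, y₀) ρ) C M₁ M₂)
    (hint : ∀ z ∈ closedBall (s₀, y₀) ρ, ∀ k l,
      fderiv ℝ Ω z (k, Ω z k) l = fderiv ℝ Ω z (l, Ω z l) k)
    {k h : B} (hk : ‖k‖ ≤ ρ) (hkh : ‖k + h‖ ≤ ρ) (hh : C * ‖h‖ ≤ ρ / 2) {α β : ℝ → F}
    (hα : ∀ t ∈ Icc (0 : ℝ) 1, α t ∈ closedBall y₀ (ρ / 2))
    (hβ : ∀ t ∈ Icc (0 : ℝ) 1, β t ∈ closedBall y₀ ρ)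
    (hα' : ∀ t ∈ Icc (0 : ℝ) 1, HasDerivWithinAt α (Ω (s₀ + t • k, α t) k) (Icc 0 1) t)
    (hβ' : ∀ t ∈ Icc (0 : ℝ) 1, HasDerivWithinAt β (Ω (s₀ + t • (k + h), β t) (k + h)) (Icc 0 1) t)
    (h0 : α 0 = β 0) :
    ‖β 1 - α 1 - Ω (s₀ + k, α 1) h‖ ≤
      (M₂ * (1 + C) ^ 2 * ρ + M₁ * (1 + C)) / (M₁ * ρ.toNNReal + 1 : ℝ≥0) *
        (Real.exp (M₁ * ρ.toNNReal + 1 : ℝ≥0) - 1) * ‖h‖ ^ 2 := by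
  have hρ : 0 ≤ ρ := (norm_nonneg _).trans hk
  -- The added 1 keeps the Lipschitz constant nonzero, so that Grönwall's bound has its closed form
  -- with a division by `K`.
  set K : ℝ≥0 := M₁ * ρ.toNNReal + 1 with hK
  have hK0 : (K : ℝ) ≠ 0 := by rw [hK]; positivity
  have hp : ∀ t ∈ Icc (0 : ℝ) 1, (s₀ + t • k, α t) ∈ closedBall (s₀, y₀) ρ := by
    intro t ht
    rw [← closedBall_prod_same]
    refine ⟨?_, closedBall_subset_closedBall (by linarith) (hα t ht)⟩
    simp only [mem_closedBall, dist_self_add_left, norm_smul, Real.norm_of_nonneg ht.1]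
    exact (mul_le_of_le_one_left (norm_nonneg _) ht.2).trans hk
  -- First-order guess for `β`. It is shown to solve the equation of `β` up to an error of order
  -- `‖h‖ ^ 2`, and Grönwall does the rest. Starting `α` in the half ball leaves room for this
  -- correction.
  set z : ℝ → F := fun t ↦ α t + t • Ω (s₀ + t • k, α t) h with hz
  have hΩh : ∀ t ∈ Icc (0 : ℝ) 1, ‖t • Ω (s₀ + t • k, α t) h‖ ≤ C * ‖h‖ := by
    intro t ht
    rw [norm_smul, Real.norm_of_nonneg ht.1]
    refine (mul_le_of_le_one_left (norm_nonneg _) ht.2).trans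
      ((ContinuousLinearMap.le_opNorm _ _).trans ?_)
    gcongr
    exact hb.norm_le _ (hp t ht)
  have hzmem : ∀ t ∈ Icc (0 : ℝ) 1, z t ∈ closedBall y₀ ρ := by
    intro t ht
    have h1 := mem_closedBall_iff_norm.1 (hα t ht)
    rw [mem_closedBall_iff_norm]
    calc ‖z t - y₀‖ = ‖(α t - y₀) + t • Ω (s₀ + t • k, α t) h‖ := by simp only [hz]; congr 1; abel
      _ ≤ ρ / 2 + ρ / 2 := (norm_add_le _ _).trans (add_le_add h1 ((hΩh t ht).trans hh))
      _ = ρ := by ring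
  have hw : ∀ t ∈ Icc (0 : ℝ) 1, (s₀ + t • (k + h), z t) ∈ closedBall (s₀, y₀) ρ := by
    intro t ht
    rw [← closedBall_prod_same]
    refine ⟨?_, hzmem t ht⟩
    simp only [mem_closedBall, dist_self_add_left, norm_smul, Real.norm_of_nonneg ht.1]
    exact (mul_le_of_le_one_left (norm_nonneg _) ht.2).trans hkh
  have hz' : ∀ t ∈ Icc (0 : ℝ) 1, HasDerivWithinAt z (Ω (s₀ + t • k, α t) k +
      (t • fderiv ℝ Ω (s₀ + t • k, α t) (k, Ω (s₀ + t • k, α t) k) h +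
        (1 : ℝ) • Ω (s₀ + t • k, α t) h)) (Icc 0 1) t := by
    intro t ht
    have h1 : HasDerivWithinAt (fun t : ℝ ↦ (s₀ + t • k, α t)) (k, Ω (s₀ + t • k, α t) k)
        (Icc 0 1) t := by
      have := ((hasDerivWithinAt_id t (Icc 0 1)).smul_const k).const_add s₀
      rw [one_smul] at this
      exact this.prodMk (hα' t ht)
    have h2 := (hb.diff _ (hp t ht)).hasFDerivAt.comp_hasDerivWithinAt t h1
    have h3 := h2.clm_apply (hasDerivWithinAt_const t _ h)
    rw [map_zero, add_zero] at h3
    exact (hα' t ht).add ((hasDerivWithinAt_id t (Icc 0 1)).smul h3)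
  have herr : ∀ t ∈ Icc (0 : ℝ) 1, dist (Ω (s₀ + t • k, α t) k +
      (t • fderiv ℝ Ω (s₀ + t • k, α t) (k, Ω (s₀ + t • k, α t) k) h +
        (1 : ℝ) • Ω (s₀ + t • k, α t) h)) (Ω (s₀ + t • (k + h), z t) (k + h)) ≤
      (M₂ * (1 + C) ^ 2 * ρ + M₁ * (1 + C)) * ‖h‖ ^ 2 := by
    intro t ht
    -- Integrability enters here. It replaces the derivative of `Ω` along the ray by the one in
    -- direction `(h, Ω p h)`, and `t` times this direction is exactly the displacement `w - p`.
    rw [hint _ (hp t ht) k h]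
    set p : B × F := (s₀ + t • k, α t) with hpd
    set w : B × F := (s₀ + t • (k + h), z t) with hwd
    have hwp : w - p = t • (h, Ω p h) := by
      rw [hwd, hpd, hz]
      ext <;> simp
    have hnorm : ‖w - p‖ ≤ (1 + C) * ‖h‖ := by
      rw [hwp, Prod.smul_mk]
      refine (norm_prod_le_iff.2 ⟨?_, ?_⟩)
      · rw [norm_smul, Real.norm_of_nonneg ht.1]
        exact (mul_le_of_le_one_left (norm_nonneg _) ht.2).trans
          (le_mul_of_one_le_left (norm_nonneg _) (by simp))
      · refine (hΩh t ht).trans ?_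
        gcongr
        simp
    -- The error is a Taylor remainder of `Ω` applied to `k`, plus an increment of `Ω` applied to
    -- `h`; each is quadratic in `h`.
    have e : Ω p k + (t • fderiv ℝ Ω p (h, Ω p h) k + (1 : ℝ) • Ω p h) - Ω w (k + h) =
        -((Ω w - Ω p - fderiv ℝ Ω p (w - p)) k) - (Ω w - Ω p) h := by
      rw [hwp, map_smul]
      simp
      abel
    rw [dist_eq_norm, e]
    have h1 : ‖(Ω w - Ω p - fderiv ℝ Ω p (w - p)) k‖ ≤
        (M₂ * ((1 + C) * ‖h‖) * ((1 + C) * ‖h‖)) * ρ := by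
      refine (ContinuousLinearMap.le_opNorm _ _).trans ?_
      gcongr
      refine (norm_sub_sub_fderiv_le (convex_closedBall _ _) hb.diff hb.lip_fderiv (hp t ht)
        (hw t ht)).trans ?_
      gcongr
    have h2 : ‖(Ω w - Ω p) h‖ ≤ M₁ * ((1 + C) * ‖h‖) * ‖h‖ := by
      refine (ContinuousLinearMap.le_opNorm _ _).trans ?_
      gcongr
      refine (hb.lip.norm_sub_le (hw t ht) (hp t ht)).trans ?_
      gcongr
    refine (norm_sub_le _ _).trans ?_
    rw [norm_neg]
    linarith
  have hIci : ∀ t ∈ Ico (0 : ℝ) 1, Icc (0 : ℝ) 1 ∈ 𝓝[≥] t := fun t ht ↦ Icc_mem_nhdsGE_of_mem ht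
  have hIco : ∀ t ∈ Ico (0 : ℝ) 1, t ∈ Icc (0 : ℝ) 1 := fun t ht ↦ ⟨ht.1, ht.2.le⟩
  -- `δ = 0` because `β` and `z` start together, `εf = 0` because `β` is an exact solution.
  have hg := dist_le_of_approx_trajectories_ODE_of_mem (a := 0) (b := 1) (K := K) (δ := 0)
    (v := fun t y ↦ Ω (s₀ + t • (k + h), y) (k + h)) (s := fun _ ↦ closedBall y₀ ρ) (εf := 0)
    (fun t ht ↦ (hb.lipschitzOnWith_ray hkh (hIco t ht)).weaken (by
      rw [hK]
      refine le_add_right (mul_le_mul_right ?_ _)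
      rw [← norm_toNNReal]
      exact Real.toNNReal_mono hkh))
    (fun t ht ↦ (hβ' t ht).continuousWithinAt)
    (fun t ht ↦ (hβ' t (hIco t ht)).mono_of_mem_nhdsWithin (hIci t ht))
    (fun t ht ↦ by rw [dist_self])
    (fun t ht ↦ hβ t (hIco t ht))
    (fun t ht ↦ (hz' t ht).continuousWithinAt)
    (fun t ht ↦ (hz' t (hIco t ht)).mono_of_mem_nhdsWithin (hIci t ht))
    (fun t ht ↦ herr t (hIco t ht))
    (fun t ht ↦ hzmem t (hIco t ht))
    (by simp [hz, h0]) 1 (right_mem_Icc.2 zero_le_one)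
  rw [gronwallBound_of_K_ne_0 hK0, dist_eq_norm] at hg
  have e : β 1 - z 1 = β 1 - α 1 - Ω (s₀ + k, α 1) h := by
    simp only [hz, one_smul]
    abel
  rw [e] at hg
  refine hg.trans (le_of_eq ?_)
  simp
  ring

/-- **Local Frobenius theorem** for a total differential equation `dx = Ω(s, x)`. -/
theorem exists_solution_totalDiffEq [CompleteSpace F] {Ω : B × F → B →L[ℝ] F} {U : Set (B × F)}
    (hU : IsOpen U) (hΩ : ContDiffOn ℝ ∞ Ω U)
    (hint : ∀ z ∈ U, ∀ k l, fderiv ℝ Ω z (k, Ω z k) l = fderiv ℝ Ω z (l, Ω z l) k)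
    {s₀ : B} {y₀ : F} (h₀ : (s₀, y₀) ∈ U) :
    ∃ (x : B → F) (V : Set B), IsOpen V ∧ s₀ ∈ V ∧ x s₀ = y₀ ∧ ContDiffOn ℝ ∞ x V ∧
      ∀ s ∈ V, (s, x s) ∈ U ∧ HasFDerivAt x (Ω (s, x s)) s := by
  obtain ⟨ρ, hρ, C, M₁, M₂, hsub, hb⟩ := exists_totalDiffEqBounds hU hΩ h₀
  -- Chosen to give both `δ ≤ ρ` and `C * δ ≤ ρ / 2`; the added 1 covers `C = 0`.
  set δ : ℝ := ρ / (2 * (C + 1)) with hδ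
  have hδ0 : 0 < δ := by positivity
  have hδρ : δ ≤ ρ := div_le_self hρ.le (by linarith [C.coe_nonneg])
  have hCδ : C * δ ≤ ρ / 2 := by
    rw [hδ, mul_div_assoc', div_le_div_iff₀ (by positivity) (by positivity)]
    nlinarith [C.coe_nonneg]
  have hCk : ∀ k : B, ‖k‖ < δ → C * ‖k‖ ≤ ρ / 2 := fun k hk ↦
    (mul_le_mul_of_nonneg_left hk.le C.coe_nonneg).trans hCδ
  have hex : ∀ k : B, ∃ α : ℝ → F, ‖k‖ < δ → α 0 = y₀ ∧
      (∀ t ∈ Icc (0 : ℝ) 1, α t ∈ closedBall y₀ (C * ‖k‖)) ∧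
      ∀ t ∈ Icc (0 : ℝ) 1, HasDerivWithinAt α (Ω (s₀ + t • k, α t) k) (Icc 0 1) t := by
    intro k
    by_cases hk : ‖k‖ < δ
    · obtain ⟨α, hα⟩ := hb.exists_ray_solution (hk.le.trans hδρ) (r := C * ‖k‖₊)
        (by push_cast; linarith [hCk k hk]) (by simp)
      exact ⟨α, fun _ ↦ by simpa using hα⟩
    · exact ⟨0, fun h ↦ absurd h hk⟩
  choose α hα using hex
  have hα2 : ∀ k : B, ‖k‖ < δ → ∀ t ∈ Icc (0 : ℝ) 1, α k t ∈ closedBall y₀ (ρ / 2) :=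
    fun k hk t ht ↦ closedBall_subset_closedBall (hCk k hk) ((hα k hk).2.1 t ht)
  -- The candidate is the time-one value of the ray solution. A different ray is used for each `s`,
  -- so no differentiable dependence on parameters is invoked: the quadratic estimate
  -- `norm_ray_sub_le` gives the full derivative.
  set x : B → F := fun s ↦ α (s - s₀) 1 with hx
  have hone : (1 : ℝ) ∈ Icc (0 : ℝ) 1 := right_mem_Icc.2 zero_le_one
  have hx0 : x s₀ = y₀ := by
    have := (hα 0 (by simpa using hδ0)).2.1 1 hone
    simpa [hx] using this
  have hmem : ∀ s ∈ ball s₀ δ, (s, x s) ∈ closedBall (s₀, y₀) ρ := by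
    intro s hs
    rw [← closedBall_prod_same]
    exact ⟨ball_subset_closedBall (ball_subset_ball hδρ hs),
      closedBall_subset_closedBall (by linarith) (hα2 _ (mem_ball_iff_norm.1 hs) 1 hone)⟩
  have hd : ∀ s ∈ ball s₀ δ, HasFDerivAt x (Ω (s, x s)) s := by
    intro s hs
    have hk : ‖s - s₀‖ < δ := mem_ball_iff_norm.1 hs
    rw [hasFDerivAt_iff_isLittleO_nhds_zero]
    refine Asymptotics.IsBigO.trans_isLittleO (g := fun h : B ↦ ‖h‖ ^ 2) ?_ ?_
    · refine Asymptotics.IsBigO.of_bound ((M₂ * (1 + C) ^ 2 * ρ + M₁ * (1 + C)) /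
        (M₁ * ρ.toNNReal + 1 : ℝ≥0) * (Real.exp (M₁ * ρ.toNNReal + 1 : ℝ≥0) - 1)) ?_
      have h1 : ∀ᶠ h in 𝓝 (0 : B), ‖s - s₀ + h‖ < δ := by
        refine ContinuousAt.eventually_lt (by fun_prop) continuousAt_const (by simpa using hk)
      have h2 : ∀ᶠ h in 𝓝 (0 : B), ‖h‖ < δ :=
        ContinuousAt.eventually_lt (by fun_prop) continuousAt_const (by simpa using hδ0)
      filter_upwards [h1, h2] with h hh1 hh2
      have := hb.norm_ray_sub_le (fun z hz ↦ hint z (hsub hz)) (hk.le.trans hδρ)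
        (hh1.le.trans hδρ) (hCk h hh2) (hα2 _ hk)
        (fun t ht ↦ closedBall_subset_closedBall (by linarith) (hα2 _ hh1 t ht))
        (hα _ hk).2.2 (hα _ hh1).2.2 ((hα _ hk).1.trans (hα _ hh1).1.symm)
      rw [Real.norm_of_nonneg (by positivity : 0 ≤ ‖h‖ ^ 2)]
      simp only [hx, add_sub_right_comm]
      rwa [add_sub_cancel] at this
    · simpa using (Asymptotics.isLittleO_norm_pow_id (E' := B) one_lt_two)
  refine ⟨x, ball s₀ δ, isOpen_ball, mem_ball_self hδ0, hx0, ?_, fun s hs ↦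
    ⟨hsub (hmem s hs), hd s hs⟩⟩
  exact contDiffOn_of_hasFDerivAt hΩ isOpen_ball fun s hs ↦ ⟨hsub (hmem s hs), hd s hs⟩

end Frobenius

/-! ### Left invariant frames -/

section LeftInvariantFrame

variable {E : Type*} [NormedAddCommGroup E] [NormedSpace ℝ E]
  {M : Type*} [TopologicalSpace M] [ChartedSpace E M] [Group M]

open Set Topology VectorField

theorem frameVector_eq_mulInvariantVectorField
    (b : Module.Basis (Fin 3) ℝ (GroupLieAlgebra 𝓘(ℝ, E) M)) (w : Fin 3 → ℝ) (q : M) :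
    frameVector b w q = mulInvariantVectorField (b.equivFun.symm w) q := by
  simp only [frameVector, leftFrame, mulInvariantVectorField, Module.Basis.equivFun_symm_apply,
    map_sum, map_smul]
  rfl

theorem frameVector_add (b : Module.Basis (Fin 3) ℝ (GroupLieAlgebra 𝓘(ℝ, E) M))
    (w w' : Fin 3 → ℝ) (q : M) :
    frameVector b (w + w') q = frameVector b w q + frameVector b w' q := by
  simp [frameVector, add_smul, Finset.sum_add_distrib]

theorem frameVector_smul (b : Module.Basis (Fin 3) ℝ (GroupLieAlgebra 𝓘(ℝ, E) M))
    (c : ℝ) (w : Fin 3 → ℝ) (q : M) :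
    frameVector b (c • w) q = c • frameVector b w q := by
  simp [frameVector, mul_smul, Finset.smul_sum]

theorem frameVector_neg (b : Module.Basis (Fin 3) ℝ (GroupLieAlgebra 𝓘(ℝ, E) M))
    (w : Fin 3 → ℝ) (q : M) : frameVector b (-w) q = -frameVector b w q := by
  simp [frameVector]

variable [LieGroup 𝓘(ℝ, E) ∞ M]

theorem LeftInvariantMetric.inner_frameVector (g : LeftInvariantMetric E M)
    {b : Module.Basis (Fin 3) ℝ (GroupLieAlgebra 𝓘(ℝ, E) M)} (hb : g.IsOrthonormal b)
    (w w' : Fin 3 → ℝ) (q : M) :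
    g.inner q (frameVector b w q) (frameVector b w' q) = w ⬝ᵥ w' := by
  have h : ∀ i j, g.inner q (leftFrame b i q) (leftFrame b j q) = if i = j then 1 else 0 :=
    fun i j ↦ (g.inner_leftFrame _ _ q).trans (hb i j)
  simp only [frameVector, map_sum, map_smul, _root_.sum_apply,
    _root_.smul_apply, h, dotProduct, smul_eq_mul, mul_ite, mul_one, mul_zero,
    Finset.sum_ite_eq', Finset.mem_univ, if_true]
  exact Finset.sum_congr rfl fun _ _ ↦ mul_comm _ _

theorem LeftInvariantMetric.frameVector_injective (g : LeftInvariantMetric E M)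
    {b : Module.Basis (Fin 3) ℝ (GroupLieAlgebra 𝓘(ℝ, E) M)} (hb : g.IsOrthonormal b) (q : M) :
    Function.Injective fun w ↦ frameVector b w q := by
  intro w w' h
  ext i
  have h1 := g.inner_frameVector hb w (Pi.single i 1) q
  have h2 := g.inner_frameVector hb w' (Pi.single i 1) q
  simp only at h
  rw [h] at h1
  simpa using h1.symm.trans h2

theorem mfderiv_mul_left_frameVector
    (b : Module.Basis (Fin 3) ℝ (GroupLieAlgebra 𝓘(ℝ, E) M)) (w : Fin 3 → ℝ) (a q : M) :
    mfderiv 𝓘(ℝ, E) 𝓘(ℝ, E) (fun x : M ↦ a * x) q (frameVector b w q) =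
      frameVector b w (a * q) := by
  rw [frameVector_eq_mulInvariantVectorField, frameVector_eq_mulInvariantVectorField,
    mulInvariantVectorField, mulInvariantVectorField]
  have h (c r : M) : MDifferentiableAt 𝓘(ℝ, E) 𝓘(ℝ, E) (fun x : M ↦ c * x) r :=
    (contMDiff_mul_left (I := 𝓘(ℝ, E)) (n := ∞) (a := c)).mdifferentiableAt (by simp)
  have e : (fun x : M ↦ a * q * x) = (fun x : M ↦ a * x) ∘ fun x : M ↦ q * x := by
    ext x; simp [mul_assoc]
  -- The chain rule produces the base point `q * 1`, which equals `q` only propositionally; the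
  -- tangent spaces are compared through `E`.
  have hq (r : M) (hr : r = q) (x : E) : mfderiv 𝓘(ℝ, E) 𝓘(ℝ, E) (fun x : M ↦ a * x) q x =
      mfderiv 𝓘(ℝ, E) 𝓘(ℝ, E) (fun x : M ↦ a * x) r x := by
    subst hr; rfl
  rw [e, mfderiv_comp 1 (h _ _) (h _ _)]
  exact hq _ (mul_one q) _

/-- Left invariant vector fields are smooth. -/
theorem contMDiff_infty_mulInvariantVectorField (v : GroupLieAlgebra 𝓘(ℝ, E) M) :
    ContMDiff 𝓘(ℝ, E) 𝓘(ℝ, E).tangent ∞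
      (fun q : M ↦ (mulInvariantVectorField v q : TangentBundle 𝓘(ℝ, E) M)) := by
  -- The field at `q` is the differential of multiplication at `(q, 1)` applied to `(0, v)`, a
  -- composition of smooth maps.
  let fg : M → TangentBundle 𝓘(ℝ, E) M := fun q ↦ TotalSpace.mk' E q 0
  have sfg : ContMDiff 𝓘(ℝ, E) 𝓘(ℝ, E).tangent ∞ fg := contMDiff_zeroSection _ _
  let fv : M → TangentBundle 𝓘(ℝ, E) M := fun _ ↦ TotalSpace.mk' E 1 v
  have sfv : ContMDiff 𝓘(ℝ, E) 𝓘(ℝ, E).tangent ∞ fv := contMDiff_const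
  have S₂ := contMDiff_equivTangentBundleProd_symm (I := 𝓘(ℝ, E)) (I' := 𝓘(ℝ, E)) (M := M)
    (M' := M) (n := ∞)
  have S₃ := ContMDiff.contMDiff_tangentMap (contMDiff_mul 𝓘(ℝ, E) ∞ (G := M)) (m := ∞)
    (by simp)
  convert! (S₃.comp S₂).comp (sfg.prodMk sfv) with q
  · simp [fg, fv]
  · simp only [Function.comp_apply, tangentMap, fg, fv]
    rw [mfderiv_prod_eq_add_apply ((contMDiff_mul 𝓘(ℝ, E) ∞).mdifferentiableAt (by simp))]
    change mfderiv 𝓘(ℝ, E) 𝓘(ℝ, E) (fun z : M ↦ q * z) 1 v =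
      mfderiv 𝓘(ℝ, E) 𝓘(ℝ, E) (fun z : M ↦ z * 1) q 0 +
        mfderiv 𝓘(ℝ, E) 𝓘(ℝ, E) (fun z : M ↦ q * z) 1 v
    rw [map_zero, zero_add]

theorem structureConstant_swap (g : LeftInvariantMetric E M)
    (b : Module.Basis (Fin 3) ℝ (GroupLieAlgebra 𝓘(ℝ, E) M)) (i j k : Fin 3) :
    structureConstant g b j i k = -structureConstant g b i j k := by
  have h : ⁅b j, b i⁆ = -⁅b i, b j⁆ := mlieBracket_swap_apply
  rw [structureConstant, h, map_neg]
  rfl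

/-- The bracket is again left invariant, so it is determined at the identity, where orthonormality
identifies coordinates with inner products. -/
theorem mlieBracket_leftFrame [CompleteSpace E] (g : LeftInvariantMetric E M)
    {b : Module.Basis (Fin 3) ℝ (GroupLieAlgebra 𝓘(ℝ, E) M)} (hb : g.IsOrthonormal b)
    (i j : Fin 3) (q : M) :
    mlieBracket 𝓘(ℝ, E) (leftFrame b i) (leftFrame b j) q =
      frameVector b (structureConstant g b i j) q := by
  have : LieGroup 𝓘(ℝ, E) (minSmoothness ℝ 3) M := by
    rw [minSmoothness_of_isRCLikeNormedField]; infer_instance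
  have h : mlieBracket 𝓘(ℝ, E) (leftFrame b i) (leftFrame b j) q =
      mulInvariantVectorField ⁅b i, b j⁆ q :=
    (congrFun (mulInvariantVector_mlieBracket (b i) (b j)) q).symm
  rw [h, frameVector_eq_mulInvariantVectorField]
  congr 1
  rw [eq_comm, LinearEquiv.symm_apply_eq]
  ext k
  have h1 : ∀ x : GroupLieAlgebra 𝓘(ℝ, E) M, g.inner 1 x (b k) = b.equivFun x k := by
    intro x
    conv_lhs => rw [← b.sum_equivFun x]
    rw [map_sum, _root_.sum_apply, Finset.sum_eq_single k]
    · rw [map_smul, _root_.smul_apply, hb k k]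
      simp
    · intro l _ hl
      rw [map_smul, _root_.smul_apply, hb l k, if_neg hl, smul_zero]
    · simp
  rw [structureConstant, h1]

/-- The frame field `E_i` in the chart of `M` at the identity. -/
def chartFrame (b : Module.Basis (Fin 3) ℝ (GroupLieAlgebra 𝓘(ℝ, E) M)) (i : Fin 3) (y : E) : E :=
  mpullback 𝓘(ℝ, E) 𝓘(ℝ, E) (chartAt E (1 : M)).symm (leftFrame b i) y

theorem mfderiv_symm_isInvertible {H : Type*} [NormedAddCommGroup H] [NormedSpace ℝ H]
    {S : Type*} [TopologicalSpace S] [ChartedSpace H S] [IsManifold 𝓘(ℝ, H) ∞ S]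
    {e : OpenPartialHomeomorph S H} (he : e ∈ atlas H S) {y : H} (hy : y ∈ e.target) :
    (mfderiv 𝓘(ℝ, H) 𝓘(ℝ, H) e.symm y).IsInvertible :=
  have : IsManifold 𝓘(ℝ, H) 1 S := .of_le (n := ∞) (by simp)
  ⟨(mdifferentiable_of_mem_atlas he).symm.mfderiv hy, rfl⟩

theorem mfderiv_isInvertible {H : Type*} [NormedAddCommGroup H] [NormedSpace ℝ H]
    {S : Type*} [TopologicalSpace S] [ChartedSpace H S] [IsManifold 𝓘(ℝ, H) ∞ S]
    {e : OpenPartialHomeomorph S H} (he : e ∈ atlas H S) {p : S} (hp : p ∈ e.source) :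
    (mfderiv 𝓘(ℝ, H) 𝓘(ℝ, H) e p).IsInvertible :=
  have : IsManifold 𝓘(ℝ, H) 1 S := .of_le (n := ∞) (by simp)
  ⟨(mdifferentiable_of_mem_atlas he).mfderiv hp, rfl⟩

section

variable (b : Module.Basis (Fin 3) ℝ (GroupLieAlgebra 𝓘(ℝ, E) M)) (i : Fin 3)

theorem isManifold_of_lieGroup : IsManifold 𝓘(ℝ, E) ∞ M :=
  ContMDiffMul.toIsManifold

theorem mfderiv_chartFrame {y : E} (hy : y ∈ (chartAt E (1 : M)).target) :
    mfderiv 𝓘(ℝ, E) 𝓘(ℝ, E) (chartAt E (1 : M)).symm y (chartFrame (E := E) b i y) =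
      leftFrame b i ((chartAt E (1 : M)).symm y) := by
  have : IsManifold 𝓘(ℝ, E) ∞ M := isManifold_of_lieGroup
  obtain ⟨A, hA⟩ := mfderiv_symm_isInvertible (chart_mem_atlas E (1 : M)) hy
  rw [chartFrame, mpullback_apply, ← hA, ContinuousLinearMap.inverse_equiv]
  exact A.apply_symm_apply _

theorem contMDiffAt_chart_symm {y : E} (hy : y ∈ (chartAt E (1 : M)).target) :
    ContMDiffAt 𝓘(ℝ, E) 𝓘(ℝ, E) ∞ (chartAt E (1 : M)).symm y :=
  have : IsManifold 𝓘(ℝ, E) ∞ M := isManifold_of_lieGroup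
  (contMDiffOn_chart_symm (I := 𝓘(ℝ, E))).contMDiffAt ((chartAt E (1 : M)).open_target.mem_nhds hy)

theorem contDiffOn_chartFrame [CompleteSpace E] :
    ContDiffOn ℝ ∞ (chartFrame b i) (chartAt E (1 : M)).target := by
  intro y hy
  have : IsManifold 𝓘(ℝ, E) ∞ M := isManifold_of_lieGroup
  have h := ContMDiffAt.mpullback_vectorField_preimage (m := ∞)
    (contMDiff_infty_mulInvariantVectorField (b i) _)
    (contMDiffAt_chart_symm hy)
    (mfderiv_symm_isInvertible (chart_mem_atlas E (1 : M)) hy) (by simp)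
  rw [contMDiffAt_vectorSpace_iff_contDiffAt] at h
  exact h.contDiffWithinAt

/-- Pullback by a chart commutes with brackets, so the coefficients stay constant. The chart at the
identity suffices, since primitives can be left translated into it. -/
theorem lieBracket_chartFrame [CompleteSpace E] (g : LeftInvariantMetric E M)
    (hb : g.IsOrthonormal b) (j : Fin 3) {y : E} (hy : y ∈ (chartAt E (1 : M)).target) :
    lieBracket ℝ (chartFrame b i) (chartFrame b j) y =
      ∑ k, structureConstant g b i j k • chartFrame b k y := by
  have : IsManifold 𝓘(ℝ, E) ∞ M := isManifold_of_lieGroup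
  have : IsManifold 𝓘(ℝ, E) (minSmoothness ℝ 2) M := by
    rw [minSmoothness_of_isRCLikeNormedField]; infer_instance
  have : IsManifold 𝓘(ℝ, E) (minSmoothness ℝ 3) M := by
    rw [minSmoothness_of_isRCLikeNormedField]; infer_instance
  have hd (i : Fin 3) (q : M) : MDiffAt (T% (leftFrame b i)) q :=
    (contMDiff_infty_mulInvariantVectorField (b i)).mdifferentiableAt (by simp)
  have h := mpullback_mlieBracket (hd i _) (hd j _) (contMDiffAt_chart_symm hy)
    (by rw [minSmoothness_of_isRCLikeNormedField]; exact ENat.LEInfty.out)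
  have h2 := mlieBracketWithin_eq_lieBracketWithin (𝕜 := ℝ) (E := E) (V := chartFrame b i)
    (W := chartFrame b j)
    (s := univ)
  rw [← lieBracketWithin_univ]
  refine (congrFun h2 y).symm.trans (h.symm.trans ?_)
  rw [mpullback_apply, mlieBracket_leftFrame g hb, frameVector]
  simp only [map_sum, map_smul]
  rfl

end

end LeftInvariantFrame

/-! ### Local primitives of Lie algebra valued one-forms -/

section LocalPrimitive

variable {E : Type*} [NormedAddCommGroup E] [NormedSpace ℝ E]
  {M : Type*} [TopologicalSpace M] [ChartedSpace E M] [Group M]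

open Set Topology VectorField

section Pfaffian

variable {B : Type*} [NormedAddCommGroup B] [NormedSpace ℝ B]

/-- The right hand side of the total differential equation `dx = ∑ η_i E_i(x)` in the chart of `M`
at the identity. -/
def pfaffian (b : Module.Basis (Fin 3) ℝ (GroupLieAlgebra 𝓘(ℝ, E) M)) (η : B → B →L[ℝ] (Fin 3 → ℝ))
    (z : B × E) : B →L[ℝ] E :=
  ∑ i, ((ContinuousLinearMap.proj i).comp (η z.1)).smulRight (chartFrame b i z.2)

theorem pfaffian_apply (b : Module.Basis (Fin 3) ℝ (GroupLieAlgebra 𝓘(ℝ, E) M))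
    (η : B → B →L[ℝ] (Fin 3 → ℝ)) (z : B × E) (k : B) :
    pfaffian b η z k = ∑ i, η z.1 k i • chartFrame b i z.2 := by
  simp [pfaffian, _root_.sum_apply]

variable [LieGroup 𝓘(ℝ, E) ∞ M] [CompleteSpace E]
  (b : Module.Basis (Fin 3) ℝ (GroupLieAlgebra 𝓘(ℝ, E) M)) {η : B → B →L[ℝ] (Fin 3 → ℝ)}
  {V : Set B}

theorem contDiffOn_pfaffian (hη : ContDiffOn ℝ ∞ η V) :
    ContDiffOn ℝ ∞ (pfaffian b η) (V ×ˢ (chartAt E (1 : M)).target) := by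
  refine ContDiffOn.sum fun i _ ↦ ?_
  have h1 : ContDiffOn ℝ ∞ (fun z : B × E ↦ η z.1) (V ×ˢ (chartAt E (1 : M)).target) :=
    hη.comp contDiffOn_fst fun z hz ↦ hz.1
  have h2 : ContDiffOn ℝ ∞ (fun z : B × E ↦ chartFrame b i z.2)
      (V ×ˢ (chartAt E (1 : M)).target) :=
    (contDiffOn_chartFrame b i).comp contDiffOn_snd fun z hz ↦ hz.2
  exact (contDiffOn_const.clm_comp h1).smulRight h2

theorem fderiv_pfaffian_apply (hV : IsOpen V) (hη : ContDiffOn ℝ ∞ η V) {z : B × E}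
    (hz : z ∈ V ×ˢ (chartAt E (1 : M)).target) (k l : B) (v : E) :
    fderiv ℝ (pfaffian b η) z (k, v) l =
      ∑ i, (fderiv ℝ η z.1 k l i • chartFrame b i z.2 +
        η z.1 l i • fderiv ℝ (chartFrame b i) z.2 v) := by
  have hU : IsOpen (V ×ˢ (chartAt E (1 : M)).target) := hV.prod (chartAt E (1 : M)).open_target
  have h0 : DifferentiableAt ℝ (pfaffian b η) z :=
    ((contDiffOn_pfaffian b hη).contDiffAt (hU.mem_nhds hz)).differentiableAt (by simp)
  have h1 : HasFDerivAt (fun z : B × E ↦ η z.1) ((fderiv ℝ η z.1).comp (.fst ℝ B E)) z :=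
    (((hη.contDiffAt (hV.mem_nhds hz.1)).differentiableAt (by simp)).hasFDerivAt).comp z
      hasFDerivAt_fst
  have h2 (i : Fin 3) : HasFDerivAt (fun z : B × E ↦ chartFrame b i z.2)
      ((fderiv ℝ (chartFrame b i) z.2).comp (.snd ℝ B E)) z :=
    ((((contDiffOn_chartFrame b i).contDiffAt
      ((chartAt E (1 : M)).open_target.mem_nhds hz.2)).differentiableAt (by simp)).hasFDerivAt).comp
        z hasFDerivAt_snd
  have h3 : HasFDerivAt (fun z ↦ pfaffian b η z l)
      ((fderiv ℝ (pfaffian b η) z).flip l) z := by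
    simpa using h0.hasFDerivAt.clm_apply (hasFDerivAt_const l z)
  have h4 (i : Fin 3) : HasFDerivAt (fun z : B × E ↦ η z.1 l i)
      ((ContinuousLinearMap.proj i).comp (((fderiv ℝ η z.1).comp (.fst ℝ B E)).flip l)) z := by
    have := h1.clm_apply (hasFDerivAt_const l z)
    rw [ContinuousLinearMap.comp_zero, zero_add] at this
    exact hasFDerivAt_pi'.1 this i
  have h6 : HasFDerivAt (fun z ↦ pfaffian b η z l) _ z :=
    (HasFDerivAt.fun_sum (u := Finset.univ) fun i _ ↦ (h4 i).smul (h2 i)).congr_of_eventuallyEq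
      (.of_forall fun z ↦ pfaffian_apply b η z l)
  have := DFunLike.congr_fun (h3.unique h6) (k, v)
  rw [ContinuousLinearMap.flip_apply] at this
  rw [this]
  simp [_root_.sum_apply, add_comm]

/-- The Maurer-Cartan equation `dη + [η, η] / 2 = 0` for an `ℝ³`-valued one-form on an open set of a
normed space, with respect to the structure constants `c`. -/
def MaurerCartanOn (c : Fin 3 → Fin 3 → Fin 3 → ℝ) (η : B → B →L[ℝ] (Fin 3 → ℝ)) (V : Set B) :
    Prop :=
  ∀ s ∈ V, ∀ k l m, fderiv ℝ η s k l m - fderiv ℝ η s l k m +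
    ∑ i, ∑ j, η s l i * η s k j * c j i m = 0

/-- Antisymmetrizing the derivative of `∑ η_i E_i` leaves `dη` plus quadratic terms in `η` times
brackets of the frame. The coefficient of each `E_m` is the Maurer-Cartan expression. -/
theorem pfaffian_integrable (g : LeftInvariantMetric E M) (hb : g.IsOrthonormal b) (hV : IsOpen V)
    (hη : ContDiffOn ℝ ∞ η V) (hmc : MaurerCartanOn (structureConstant g b) η V) {z : B × E}
    (hz : z ∈ V ×ˢ (chartAt E (1 : M)).target) (k l : B) :
    fderiv ℝ (pfaffian b η) z (k, pfaffian b η z k) l =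
      fderiv ℝ (pfaffian b η) z (l, pfaffian b η z l) k := by
  rw [← sub_eq_zero, fderiv_pfaffian_apply b hV hη hz, fderiv_pfaffian_apply b hV hη hz,
    pfaffian_apply, pfaffian_apply]
  simp only [map_sum, map_smul, Finset.sum_add_distrib, Finset.smul_sum]
  -- Exchanging the indices in one double sum pairs its terms with the other, so that the
  -- derivatives combine into Lie brackets.
  have h1 : ∑ i, ∑ j, η z.1 k i • η z.1 l j • fderiv ℝ (chartFrame b i) z.2 (chartFrame b j z.2) =
      ∑ i, ∑ j, η z.1 l i • η z.1 k j • fderiv ℝ (chartFrame b j) z.2 (chartFrame b i z.2) := by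
    rw [Finset.sum_comm]
    exact Finset.sum_congr rfl fun i _ ↦ Finset.sum_congr rfl fun j _ ↦ smul_comm _ _ _
  have h2 : ∀ i j, fderiv ℝ (chartFrame b i) z.2 (chartFrame b j z.2) -
      fderiv ℝ (chartFrame b j) z.2 (chartFrame b i z.2) =
        ∑ m, structureConstant g b j i m • chartFrame b m z.2 := fun i j ↦
    lieBracket_chartFrame b j g hb i hz.2
  rw [h1, add_sub_add_comm, ← Finset.sum_sub_distrib, ← Finset.sum_sub_distrib]
  simp only [← Finset.sum_sub_distrib, ← smul_sub, ← sub_smul, h2, Finset.smul_sum, smul_smul]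
  have h3 : ∑ i, ∑ j, ∑ m, (η z.1 l i * η z.1 k j * structureConstant g b j i m) •
      chartFrame b m z.2 = ∑ m, (∑ i, ∑ j, η z.1 l i * η z.1 k j * structureConstant g b j i m) •
        chartFrame b m z.2 := by
    simp only [Finset.sum_smul]
    rw [Finset.sum_comm]
    refine (Finset.sum_congr rfl fun i _ ↦ Finset.sum_comm).trans ?_
    rw [Finset.sum_comm]
    refine (Finset.sum_congr rfl fun i _ ↦ Finset.sum_comm)
  rw [h3, ← Finset.sum_add_distrib]
  refine Finset.sum_eq_zero fun m _ ↦ ?_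
  rw [← add_smul, hmc z.1 hz.1 k l m, zero_smul]

end Pfaffian

variable {S : Type*} [TopologicalSpace S] [ChartedSpace (ℝ × ℝ) S]

/-- `φ` is a primitive of the one-form `θ` at `p`: it is smooth and `dφ(X) = ∑ θ_i(X) E_i(φ)`. -/
def IsPrimitiveAt (b : Module.Basis (Fin 3) ℝ (GroupLieAlgebra 𝓘(ℝ, E) M))
    (θ : Π p : S, TangentSpace 𝓘(ℝ, ℝ × ℝ) p →L[ℝ] (Fin 3 → ℝ)) (φ : S → M) (p : S) : Prop :=
  ContMDiffAt 𝓘(ℝ, ℝ × ℝ) 𝓘(ℝ, E) ∞ φ p ∧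
    ∀ X, mfderiv 𝓘(ℝ, ℝ × ℝ) 𝓘(ℝ, E) φ p X = frameVector b (θ p X) (φ p)

theorem IsPrimitiveAt.congr_of_eventuallyEq
    {b : Module.Basis (Fin 3) ℝ (GroupLieAlgebra 𝓘(ℝ, E) M)}
    {θ : Π p : S, TangentSpace 𝓘(ℝ, ℝ × ℝ) p →L[ℝ] (Fin 3 → ℝ)} {φ ψ : S → M} {p : S}
    (h : IsPrimitiveAt b θ φ p)
    (hψ : ψ =ᶠ[𝓝 p] φ) : IsPrimitiveAt b θ ψ p := by
  refine ⟨h.1.congr_of_eventuallyEq hψ, fun X ↦ ?_⟩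
  have h1 : HasMFDerivAt 𝓘(ℝ, ℝ × ℝ) 𝓘(ℝ, E) ψ p (mfderiv 𝓘(ℝ, ℝ × ℝ) 𝓘(ℝ, E) φ p) :=
    (h.1.mdifferentiableAt (by simp)).hasMFDerivAt.congr_of_eventuallyEq hψ
  have h2 (q : M) (hq : q = φ p) (w : Fin 3 → ℝ) :
      (frameVector b w (φ p) : E) = frameVector b w q := by
    subst hq; rfl
  rw [h1.mfderiv]
  exact (h.2 X).trans (h2 _ hψ.eq_of_nhds _)

/-- The frame is left invariant, so the equation does not see left translations. -/
theorem IsPrimitiveAt.mul_left [LieGroup 𝓘(ℝ, E) ∞ M]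
    {b : Module.Basis (Fin 3) ℝ (GroupLieAlgebra 𝓘(ℝ, E) M)}
    {θ : Π p : S, TangentSpace 𝓘(ℝ, ℝ × ℝ) p →L[ℝ] (Fin 3 → ℝ)} {φ : S → M} {p : S}
    (h : IsPrimitiveAt b θ φ p) (a : M) :
    IsPrimitiveAt b θ (fun q ↦ a * φ q) p := by
  have h1 : ContMDiff 𝓘(ℝ, E) 𝓘(ℝ, E) ∞ (fun x : M ↦ a * x) := contMDiff_mul_left
  refine ⟨h1.contMDiffAt.comp p h.1, fun X ↦ ?_⟩
  have h2 : (fun q ↦ a * φ q) = (fun x : M ↦ a * x) ∘ φ := rfl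
  rw [h2, mfderiv_comp p (h1.mdifferentiableAt (by simp)) (h.1.mdifferentiableAt (by simp))]
  change mfderiv 𝓘(ℝ, E) 𝓘(ℝ, E) (fun x : M ↦ a * x) (φ p)
    (mfderiv 𝓘(ℝ, ℝ × ℝ) 𝓘(ℝ, E) φ p X) = _
  rw [h.2]
  exact mfderiv_mul_left_frameVector b (θ p X) a (φ p)

/-- The expression of the one-form `θ` in the chart `e`. -/
def coordForm (θ : Π p : S, TangentSpace 𝓘(ℝ, ℝ × ℝ) p →L[ℝ] (Fin 3 → ℝ))
    (e : OpenPartialHomeomorph S (ℝ × ℝ)) (s : ℝ × ℝ) : ℝ × ℝ →L[ℝ] (Fin 3 → ℝ) :=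
  (θ (e.symm s)).comp (mfderiv 𝓘(ℝ, ℝ × ℝ) 𝓘(ℝ, ℝ × ℝ) e.symm s)

variable [IsManifold 𝓘(ℝ, ℝ × ℝ) ∞ S] {e : OpenPartialHomeomorph S (ℝ × ℝ)}
  {θ : Π p : S, TangentSpace 𝓘(ℝ, ℝ × ℝ) p →L[ℝ] (Fin 3 → ℝ)}
  {b : Module.Basis (Fin 3) ℝ (GroupLieAlgebra 𝓘(ℝ, E) M)}

theorem coordForm_mfderiv (he : e ∈ atlas (ℝ × ℝ) S) {p : S} (hp : p ∈ e.source)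
    (X : TangentSpace 𝓘(ℝ, ℝ × ℝ) p) :
    coordForm θ e (e p) (mfderiv 𝓘(ℝ, ℝ × ℝ) 𝓘(ℝ, ℝ × ℝ) e p X) = θ p X := by
  have : IsManifold 𝓘(ℝ, ℝ × ℝ) 1 S := .of_le (n := ∞) (by simp)
  have h := DFunLike.congr_fun ((mdifferentiable_of_mem_atlas he).symm_comp_deriv hp) X
  have h2 (q : S) (hq : q = p) (X : ℝ × ℝ) : (θ q : ℝ × ℝ →L[ℝ] (Fin 3 → ℝ)) X = θ p X := by
    subst hq; rfl
  refine Eq.trans (h2 _ (e.left_inv hp) _) ?_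
  exact congrArg (θ p) h

variable [LieGroup 𝓘(ℝ, E) ∞ M]

theorem exists_isPrimitiveAt [CompleteSpace E] (g : LeftInvariantMetric E M)
    (hb : g.IsOrthonormal b) (he : e ∈ atlas (ℝ × ℝ) S)
    (hη : ContDiffOn ℝ ∞ (coordForm θ e) e.target)
    (hmc : MaurerCartanOn (structureConstant g b) (coordForm θ e) e.target) {p₀ : S}
    (hp₀ : p₀ ∈ e.source) :
    ∃ (φ : S → M) (W : Set S), IsOpen W ∧ p₀ ∈ W ∧ ∀ p ∈ W, IsPrimitiveAt b θ φ p := by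
  set χ := chartAt E (1 : M) with hχ
  obtain ⟨x, V, hV, hsV, -, hxs, hx⟩ := exists_solution_totalDiffEq
    (e.open_target.prod χ.open_target) (contDiffOn_pfaffian b hη)
    (fun z hz ↦ pfaffian_integrable b g hb e.open_target hη hmc hz)
    (s₀ := e p₀) (y₀ := χ 1) ⟨e.map_source hp₀, χ.map_source (mem_chart_source E 1)⟩
  refine ⟨χ.symm ∘ x ∘ e, e.source ∩ e ⁻¹' V, e.isOpen_inter_preimage hV, ⟨hp₀, hsV⟩, ?_⟩
  rintro p ⟨hp, hpV⟩
  have c1 : ContMDiffAt 𝓘(ℝ, ℝ × ℝ) 𝓘(ℝ, ℝ × ℝ) ∞ e p :=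
    contMDiffAt_of_mem_maximalAtlas (IsManifold.subset_maximalAtlas he) hp
  have c2 : ContMDiffAt 𝓘(ℝ, ℝ × ℝ) 𝓘(ℝ, E) ∞ x (e p) :=
    (hxs.contDiffAt (hV.mem_nhds hpV)).contMDiffAt
  have c3 : ContMDiffAt 𝓘(ℝ, E) 𝓘(ℝ, E) ∞ χ.symm (x (e p)) :=
    contMDiffAt_chart_symm (hx _ hpV).1.2
  refine ⟨c3.comp p (c2.comp p c1), fun X ↦ ?_⟩
  rw [mfderiv_comp p (c3.mdifferentiableAt (by simp))
    ((c2.comp p c1).mdifferentiableAt (by simp)), mfderiv_comp p (c2.mdifferentiableAt (by simp))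
    (c1.mdifferentiableAt (by simp)), mfderiv_eq_fderiv, (hx _ hpV).2.fderiv]
  change mfderiv 𝓘(ℝ, E) 𝓘(ℝ, E) χ.symm (x (e p)) (pfaffian b (coordForm θ e) (e p, x (e p))
    (mfderiv 𝓘(ℝ, ℝ × ℝ) 𝓘(ℝ, ℝ × ℝ) e p X)) = frameVector b (θ p X) (χ.symm (x (e p)))
  refine (congrArg (mfderiv 𝓘(ℝ, E) 𝓘(ℝ, E) χ.symm (x (e p)))
    (pfaffian_apply b (coordForm θ e) (e p, x (e p)) _)).trans ((map_sum _ _ _).trans ?_)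
  rw [frameVector]
  refine Finset.sum_congr rfl fun i _ ↦ ?_
  refine (map_smul _ _ _).trans ?_
  have h1 := mfderiv_chartFrame b i (hx _ hpV).1.2
  have h2 := congrFun (coordForm_mfderiv (θ := θ) he hp X) i
  exact congrArg₂ (fun (c : ℝ) (v : E) ↦ c • v) h2 h1

/-- The converse passage, from primitives to the total differential equation; it makes local
uniqueness available. -/
theorem hasFDerivAt_chart_of_isPrimitiveAt (he : e ∈ atlas (ℝ × ℝ) S) {φ : S → M} {s : ℝ × ℝ}
    (hs : s ∈ e.target) (h : IsPrimitiveAt b θ φ (e.symm s))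
    (hφ : φ (e.symm s) ∈ (chartAt E (1 : M)).source) :
    HasFDerivAt (chartAt E (1 : M) ∘ φ ∘ e.symm)
      (pfaffian b (coordForm θ e) (s, (chartAt E (1 : M) ∘ φ ∘ e.symm) s)) s := by
  have hM : IsManifold 𝓘(ℝ, E) ∞ M := isManifold_of_lieGroup
  have hM1 : IsManifold 𝓘(ℝ, E) 1 M := .of_le (n := ∞) (by simp)
  set χ := chartAt E (1 : M) with hχ
  have c1 : ContMDiffAt 𝓘(ℝ, ℝ × ℝ) 𝓘(ℝ, ℝ × ℝ) ∞ e.symm s :=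
    contMDiffAt_symm_of_mem_maximalAtlas (IsManifold.subset_maximalAtlas he) hs
  have c3 : ContMDiffAt 𝓘(ℝ, E) 𝓘(ℝ, E) ∞ χ (φ (e.symm s)) :=
    contMDiffAt_of_mem_maximalAtlas (IsManifold.subset_maximalAtlas (chart_mem_atlas E 1)) hφ
  have c := c3.comp s (h.1.comp s c1)
  have d := (contMDiffAt_iff_contDiffAt.1 c).differentiableAt (by simp)
  suffices h0 : pfaffian b (coordForm θ e) (s, (χ ∘ φ ∘ e.symm) s) =
      fderiv ℝ (χ ∘ φ ∘ e.symm) s by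
    rw [h0]
    exact d.hasFDerivAt
  rw [← mfderiv_eq_fderiv, mfderiv_comp s (c3.mdifferentiableAt (by simp))
    ((h.1.comp s c1).mdifferentiableAt (by simp)),
    mfderiv_comp s (h.1.mdifferentiableAt (by simp)) (c1.mdifferentiableAt (by simp))]
  refine ContinuousLinearMap.ext fun k ↦ ?_
  change pfaffian b (coordForm θ e) (s, χ (φ (e.symm s))) k =
    mfderiv 𝓘(ℝ, E) 𝓘(ℝ, E) χ (φ (e.symm s)) (mfderiv 𝓘(ℝ, ℝ × ℝ) 𝓘(ℝ, E) φ (e.symm s)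
      (mfderiv 𝓘(ℝ, ℝ × ℝ) 𝓘(ℝ, ℝ × ℝ) e.symm s k))
  rw [h.2, pfaffian_apply, frameVector]
  refine Eq.trans ?_ (map_sum _ _ _).symm
  refine Finset.sum_congr rfl fun i _ ↦ ?_
  refine Eq.trans ?_ (map_smul _ _ _).symm
  refine congrArg (fun v : E ↦ coordForm θ e s k i • v) ?_
  have h1 := mfderiv_chartFrame b i (χ.map_source hφ)
  have h2 := DFunLike.congr_fun ((mdifferentiable_of_mem_atlas (I := 𝓘(ℝ, E))
    (chart_mem_atlas E (1 : M))).comp_symm_deriv (χ.map_source hφ))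
    (chartFrame (E := E) b i (χ (φ (e.symm s))))
  have h3 (q r : M) (hq : q = r) : (mfderiv 𝓘(ℝ, E) 𝓘(ℝ, E) χ q (leftFrame b i q) : E) =
    mfderiv 𝓘(ℝ, E) 𝓘(ℝ, E) χ r (leftFrame b i r) := by subst hq; rfl
  exact (h2.symm.trans (congrArg (mfderiv 𝓘(ℝ, E) 𝓘(ℝ, E) χ (χ.symm (χ (φ (e.symm s))))) h1)).trans
    (h3 _ _ (χ.left_inv hφ))

/-- Both maps are translated to take the value 1 at `p₀`. Near `p₀` they then lie in the chart at
the identity and solve the same equation with the same initial value. -/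
theorem IsPrimitiveAt.eventually_eq [CompleteSpace E] (he : e ∈ atlas (ℝ × ℝ) S)
    (hη : ContDiffOn ℝ ∞ (coordForm θ e) e.target) {p₀ : S} (hp₀ : p₀ ∈ e.source) {φ ψ : S → M}
    (hφ : ∀ᶠ p in 𝓝 p₀, IsPrimitiveAt b θ φ p) (hψ : ∀ᶠ p in 𝓝 p₀, IsPrimitiveAt b θ ψ p) :
    ∀ᶠ p in 𝓝 p₀, ψ p = ψ p₀ * (φ p₀)⁻¹ * φ p := by
  set χ := chartAt E (1 : M) with hχ
  have htend : Filter.Tendsto e.symm (𝓝 (e p₀)) (𝓝 p₀) := e.tendsto_symm hp₀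
  have key : ∀ f : S → M, (∀ᶠ p in 𝓝 p₀, IsPrimitiveAt b θ f p) →
      (∀ᶠ s in 𝓝 (e p₀), HasFDerivAt (χ ∘ (fun q ↦ (f p₀)⁻¹ * f q) ∘ e.symm)
        (pfaffian b (coordForm θ e) (s, (χ ∘ (fun q ↦ (f p₀)⁻¹ * f q) ∘ e.symm) s)) s) ∧
      ∀ᶠ p in 𝓝 p₀, (f p₀)⁻¹ * f p ∈ χ.source := by
    intro f hf
    have hf' : ∀ᶠ p in 𝓝 p₀, IsPrimitiveAt b θ (fun q ↦ (f p₀)⁻¹ * f q) p :=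
      hf.mono fun p hp ↦ hp.mul_left _
    have hsrc : ∀ᶠ p in 𝓝 p₀, (f p₀)⁻¹ * f p ∈ χ.source := by
      refine hf'.self_of_nhds.1.continuousAt (χ.open_source.mem_nhds ?_)
      rw [inv_mul_cancel]
      exact mem_chart_source E 1
    refine ⟨?_, hsrc⟩
    filter_upwards [htend.eventually hf', htend.eventually hsrc,
      e.open_target.mem_nhds (e.map_source hp₀)] with s h1 h2 h3
    exact hasFDerivAt_chart_of_isPrimitiveAt he h3 h1 h2
  obtain ⟨d1, s1⟩ := key φ hφ
  obtain ⟨d2, s2⟩ := key ψ hψ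
  have h0 : ∀ f : S → M, (χ ∘ (fun q ↦ (f p₀)⁻¹ * f q) ∘ e.symm) (e p₀) = χ 1 := by
    intro f
    simp [e.left_inv hp₀]
  have heq := eventuallyEq_of_hasFDerivAt (e.open_target.prod χ.open_target)
    (contDiffOn_pfaffian b hη)
    ⟨e.map_source hp₀, by
      have h := χ.map_source (mem_chart_source E (1 : M))
      rw [← h0 φ] at h
      exact h⟩ d1 d2
    ((h0 φ).trans (h0 ψ).symm)
  filter_upwards [(e.continuousAt hp₀).eventually heq, e.open_source.mem_nhds hp₀, s1, s2]
    with p h1 h2 h3 h4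
  have h5 : χ ((φ p₀)⁻¹ * φ p) = χ ((ψ p₀)⁻¹ * ψ p) := by
    simpa [e.left_inv h2] using h1
  rw [mul_assoc, χ.injOn h3 h4 h5, mul_inv_cancel_left]

end LocalPrimitive

/-! ### Global primitives on simply connected surfaces -/

section GlobalPrimitive

open Set Topology

/-- Local maps to a group that agree up to locally constant left translations glue to a global map
on a simply connected space. -/
theorem exists_glue_of_left_translation {X G : Type*} [TopologicalSpace X]
    [SimplyConnectedSpace X] [LocallyPathConnectedSpace X] [Group G] (W : X → Set X)
    (hWo : ∀ x, IsOpen (W x)) (hW : ∀ x, x ∈ W x) (φ : X → X → G)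
    (h : ∀ i j, ∀ x ∈ W i ∩ W j, ∀ᶠ y in 𝓝 x, φ j y = φ j x * (φ i x)⁻¹ * φ i y) :
    ∃ f : X → G, ∀ x, ∃ c : G, ∀ᶠ y in 𝓝 x, f y = c * φ x y := by
  -- For the discrete topology, locally constant transition factors are exactly what continuity of
  -- the coordinate changes requires.
  let _ : TopologicalSpace G := ⊥
  have : DiscreteTopology G := ⟨rfl⟩
  -- A fibre coordinate `v` in the trivialization `i` stands for the local map `v * φ i`; changing
  -- to `j` keeps its value at `x`.
  let Z : FiberBundleCore X X G :=
    { baseSet := W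
      isOpen_baseSet := hWo
      indexAt := id
      mem_baseSet_at := hW
      coordChange := fun i j x v ↦ v * φ i x * (φ j x)⁻¹
      coordChange_self := fun i x _ v ↦ by group
      continuousOn_coordChange := by
        rintro i j ⟨x, v⟩ ⟨hx, -⟩
        refine ContinuousAt.continuousWithinAt ?_
        refine Filter.EventuallyEq.continuousAt (y := v * φ i x * (φ j x)⁻¹) ?_
        have hv : ∀ᶠ w in 𝓝 v, w = v := by
          rw [nhds_discrete G]
          exact Filter.eventually_pure.2 rfl
        filter_upwards [(h i j x hx).prodMk_nhds hv]
        rintro ⟨y, w⟩ ⟨hy, rfl⟩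
        simp only at hy ⊢
        rw [hy]
        group
      coordChange_comp := fun i j k x _ v ↦ by group }
  have hcov : IsCoveringMap (π G Z.Fiber) := FiberBundle.isCoveringMap
  obtain ⟨x₀⟩ : Nonempty X := inferInstance
  -- Simple connectedness lifts the identity to the covering, i.e. gives a global section.
  obtain ⟨F, ⟨-, hF⟩, -⟩ := hcov.existsUnique_continuousMap_lifts (ContinuousMap.id X) x₀
    (⟨x₀, (1 : G)⟩ : Z.TotalSpace) rfl
  have hF' : ∀ y, (F y).proj = y := fun y ↦ congrFun hF y
  refine ⟨fun y ↦ (show G from (F y).2) * φ (F y).proj (F y).proj, fun x ↦ ?_⟩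
  -- In the fixed trivialization at `x` the section is continuous into a discrete set, hence locally
  -- constant; its value is the factor `c`.
  have hc : ContinuousAt (fun y ↦ (Z.localTriv x (F y)).2) x := by
    have h1 : ContinuousAt (Z.localTriv x) (F x) :=
      (Z.localTriv x).continuousAt (by
        rw [Trivialization.mem_source]
        change (F x).proj ∈ W x
        rw [hF' x]
        exact hW x)
    exact continuous_snd.continuousAt.comp (h1.comp F.continuous.continuousAt)
  have h2 : ∀ᶠ y in 𝓝 x, (Z.localTriv x (F y)).2 = (Z.localTriv x (F x)).2 := by
    have := hc.tendsto
    rw [nhds_discrete G, Filter.tendsto_pure] at this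
    exact this
  refine ⟨(Z.localTriv x (F x)).2, h2.mono fun y hy ↦ ?_⟩
  rw [← hy]
  change _ = (show G from (F y).2) * φ (F y).proj (F y).proj * (φ x (F y).proj)⁻¹ * φ x y
  rw [(congrArg (φ x) (hF' y) : φ x (F y).proj = φ x y), inv_mul_cancel_right]

variable {E : Type*} [NormedAddCommGroup E] [NormedSpace ℝ E] [CompleteSpace E]
  {M : Type*} [TopologicalSpace M] [ChartedSpace E M] [Group M] [LieGroup 𝓘(ℝ, E) ∞ M]
  {S : Type*} [TopologicalSpace S] [ChartedSpace (ℝ × ℝ) S] [IsManifold 𝓘(ℝ, ℝ × ℝ) ∞ S]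
  {θ : Π p : S, TangentSpace 𝓘(ℝ, ℝ × ℝ) p →L[ℝ] (Fin 3 → ℝ)}
  {b : Module.Basis (Fin 3) ℝ (GroupLieAlgebra 𝓘(ℝ, E) M)}

/-- A one-form satisfying the Maurer-Cartan equation has a global primitive on a simply connected
surface. -/
theorem exists_forall_isPrimitiveAt [SimplyConnectedSpace S] (g : LeftInvariantMetric E M)
    (hb : g.IsOrthonormal b)
    (hη : ∀ e ∈ atlas (ℝ × ℝ) S, ContDiffOn ℝ ∞ (coordForm θ e) e.target)
    (hmc : ∀ e ∈ atlas (ℝ × ℝ) S,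
      MaurerCartanOn (structureConstant g b) (coordForm θ e) e.target) :
    ∃ φ : S → M, ∀ p, IsPrimitiveAt b θ φ p := by
  have hloc (p : S) := exists_isPrimitiveAt g hb (chart_mem_atlas (ℝ × ℝ) p)
    (hη _ (chart_mem_atlas (ℝ × ℝ) p)) (hmc _ (chart_mem_atlas (ℝ × ℝ) p))
    (mem_chart_source (ℝ × ℝ) p)
  choose φ W hWo hW hφ using hloc
  have : LocallyPathConnectedSpace S := ChartedSpace.locallyPathConnectedSpace (ℝ × ℝ) S
  obtain ⟨f, hf⟩ := exists_glue_of_left_translation W hWo hW φ fun i j x hx ↦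
    IsPrimitiveAt.eventually_eq (chart_mem_atlas (ℝ × ℝ) x) (hη _ (chart_mem_atlas (ℝ × ℝ) x))
      (mem_chart_source (ℝ × ℝ) x)
      (((hWo i).eventually_mem hx.1).mono fun y hy ↦ hφ i y hy)
      (((hWo j).eventually_mem hx.2).mono fun y hy ↦ hφ j y hy)
  refine ⟨f, fun p ↦ ?_⟩
  obtain ⟨c, hc⟩ := hf p
  exact ((hφ p p (hW p)).mul_left c).congr_of_eventuallyEq hc

/-- Primitives on a connected surface are unique up to left translations. -/
theorem exists_eq_mul_of_isPrimitiveAt [PreconnectedSpace S] [Nonempty S]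
    (hη : ∀ e ∈ atlas (ℝ × ℝ) S, ContDiffOn ℝ ∞ (coordForm θ e) e.target) {φ ψ : S → M}
    (hφ : ∀ p, IsPrimitiveAt b θ φ p) (hψ : ∀ p, IsPrimitiveAt b θ ψ p) :
    ∃ a : M, ∀ p, ψ p = a * φ p := by
  -- Local uniqueness says that this quotient is locally constant; connectedness makes it constant.
  have hlc : IsLocallyConstant fun p ↦ ψ p * (φ p)⁻¹ := by
    rw [IsLocallyConstant.iff_eventually_eq]
    intro p
    filter_upwards [IsPrimitiveAt.eventually_eq (chart_mem_atlas (ℝ × ℝ) p)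
      (hη _ (chart_mem_atlas (ℝ × ℝ) p)) (mem_chart_source (ℝ × ℝ) p) (.of_forall hφ)
      (.of_forall hψ)] with q hq
    rw [hq]
    group
  obtain ⟨p₀⟩ := ‹Nonempty S›
  refine ⟨ψ p₀ * (φ p₀)⁻¹, fun p ↦ ?_⟩
  rw [← hlc.apply_eq_of_preconnectedSpace p p₀, inv_mul_cancel_right]

end GlobalPrimitive

/-! ### Covariant derivatives in a frame -/

section FrameDerivative

open Set Topology

variable {S : Type*} [TopologicalSpace S] [ChartedSpace (ℝ × ℝ) S]

theorem mvfderiv_apply_component {ι : Type*} [Fintype ι] {W : S → ι → ℝ} {p : S}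
    (hW : MDifferentiableAt 𝓘(ℝ, ℝ × ℝ) 𝓘(ℝ, ι → ℝ) W p) (k : ι)
    (X : TangentSpace 𝓘(ℝ, ℝ × ℝ) p) :
    mvfderiv 𝓘(ℝ, ℝ × ℝ) (fun q ↦ W q k) p X = mvfderiv 𝓘(ℝ, ℝ × ℝ) W p X k := by
  have h := (ContinuousLinearMap.proj (R := ℝ) (φ := fun _ : ι ↦ ℝ) k).hasFDerivAt
    (x := W p) |>.hasMFDerivAt.comp p hW.hasMFDerivAt
  exact DFunLike.congr_fun h.mfderiv X

theorem mdifferentiableAt_apply_component {ι : Type*} [Fintype ι] {W : S → ι → ℝ} {p : S}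
    (hW : MDifferentiableAt 𝓘(ℝ, ℝ × ℝ) 𝓘(ℝ, ι → ℝ) W p) (k : ι) :
    MDifferentiableAt 𝓘(ℝ, ℝ × ℝ) 𝓘(ℝ, ℝ) (fun q ↦ W q k) p :=
  (((ContinuousLinearMap.proj (R := ℝ) (φ := fun _ : ι ↦ ℝ) k).hasFDerivAt
    (x := W p)).hasMFDerivAt.comp p hW.hasMFDerivAt).mdifferentiableAt

theorem mvfderiv_cross {W₁ W₂ : S → Fin 3 → ℝ} {p : S}
    (h₁ : MDifferentiableAt 𝓘(ℝ, ℝ × ℝ) 𝓘(ℝ, Fin 3 → ℝ) W₁ p)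
    (h₂ : MDifferentiableAt 𝓘(ℝ, ℝ × ℝ) 𝓘(ℝ, Fin 3 → ℝ) W₂ p)
    (h : MDifferentiableAt 𝓘(ℝ, ℝ × ℝ) 𝓘(ℝ, Fin 3 → ℝ) (fun q ↦ W₁ q ⨯₃ W₂ q) p)
    (X : TangentSpace 𝓘(ℝ, ℝ × ℝ) p) :
    mvfderiv 𝓘(ℝ, ℝ × ℝ) (fun q ↦ W₁ q ⨯₃ W₂ q) p X =
      mvfderiv 𝓘(ℝ, ℝ × ℝ) W₁ p X ⨯₃ W₂ p + W₁ p ⨯₃ mvfderiv 𝓘(ℝ, ℝ × ℝ) W₂ p X := by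
  have key (i j : Fin 3) : mvfderiv 𝓘(ℝ, ℝ × ℝ) (fun q ↦ W₁ q i * W₂ q j - W₁ q j * W₂ q i) p X =
      W₁ p i * mvfderiv 𝓘(ℝ, ℝ × ℝ) W₂ p X j + W₂ p j * mvfderiv 𝓘(ℝ, ℝ × ℝ) W₁ p X i -
      (W₁ p j * mvfderiv 𝓘(ℝ, ℝ × ℝ) W₂ p X i + W₂ p i * mvfderiv 𝓘(ℝ, ℝ × ℝ) W₁ p X j) := by
    have c₁ := mdifferentiableAt_apply_component h₁
    have c₂ := mdifferentiableAt_apply_component h₂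
    have m (i j : Fin 3) : MDifferentiableAt 𝓘(ℝ, ℝ × ℝ) 𝓘(ℝ, ℝ) (fun q ↦ W₁ q i * W₂ q j) p :=
      (c₁ i).mul (c₂ j)
    rw [mvfderiv_fun_sub (m i j) (m j i), mvfderiv_fun_mul (c₁ i) (c₂ j),
      mvfderiv_fun_mul (c₁ j) (c₂ i)]
    simp [mvfderiv_apply_component h₁, mvfderiv_apply_component h₂]
  ext k
  rw [← mvfderiv_apply_component h]
  fin_cases k
  · refine Eq.trans ?_ ((key 1 2).trans ?_)
    · simp [cross_apply]
    · simp [cross_apply]; ring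
  · refine Eq.trans ?_ ((key 2 0).trans ?_)
    · simp [cross_apply]
    · simp [cross_apply]; ring
  · refine Eq.trans ?_ ((key 0 1).trans ?_)
    · simp [cross_apply]
    · simp [cross_apply]; ring

theorem mvfderiv_dotProduct {W₁ W₂ : S → Fin 3 → ℝ} {p : S}
    (h₁ : MDifferentiableAt 𝓘(ℝ, ℝ × ℝ) 𝓘(ℝ, Fin 3 → ℝ) W₁ p)
    (h₂ : MDifferentiableAt 𝓘(ℝ, ℝ × ℝ) 𝓘(ℝ, Fin 3 → ℝ) W₂ p)
    (X : TangentSpace 𝓘(ℝ, ℝ × ℝ) p) :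
    mvfderiv 𝓘(ℝ, ℝ × ℝ) (fun q ↦ W₁ q ⬝ᵥ W₂ q) p X =
      mvfderiv 𝓘(ℝ, ℝ × ℝ) W₁ p X ⬝ᵥ W₂ p + W₁ p ⬝ᵥ mvfderiv 𝓘(ℝ, ℝ × ℝ) W₂ p X := by
  have c₁ := mdifferentiableAt_apply_component h₁
  have c₂ := mdifferentiableAt_apply_component h₂
  have e : (fun q ↦ W₁ q ⬝ᵥ W₂ q) =
      fun q ↦ W₁ q 0 * W₂ q 0 + W₁ q 1 * W₂ q 1 + W₁ q 2 * W₂ q 2 := by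
    ext q
    simp [dotProduct, Fin.sum_univ_three]
  have m (i j : Fin 3) : MDifferentiableAt 𝓘(ℝ, ℝ × ℝ) 𝓘(ℝ, ℝ) (fun q ↦ W₁ q i * W₂ q j) p :=
    (c₁ i).mul (c₂ j)
  have m' : MDifferentiableAt 𝓘(ℝ, ℝ × ℝ) 𝓘(ℝ, ℝ)
      (fun q ↦ W₁ q 0 * W₂ q 0 + W₁ q 1 * W₂ q 1) p := (m 0 0).add (m 1 1)
  rw [e, mvfderiv_fun_add m' (m 2 2), mvfderiv_fun_add (m 0 0) (m 1 1),
    mvfderiv_fun_mul (c₁ 0) (c₂ 0), mvfderiv_fun_mul (c₁ 1) (c₂ 1), mvfderiv_fun_mul (c₁ 2) (c₂ 2)]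
  simp [mvfderiv_apply_component h₁, mvfderiv_apply_component h₂, dotProduct, Fin.sum_univ_three]
  ring

section Connection

variable {Γ : Fin 3 → Fin 3 → Fin 3 → ℝ}

theorem connectionTerm_add_left (x x' y : Fin 3 → ℝ) :
    connectionTerm Γ (x + x') y = connectionTerm Γ x y + connectionTerm Γ x' y := by
  ext k
  simp [connectionTerm, add_mul, Finset.sum_add_distrib]

theorem connectionTerm_smul_left (c : ℝ) (x y : Fin 3 → ℝ) :
    connectionTerm Γ (c • x) y = c • connectionTerm Γ x y := by
  ext k
  simp [connectionTerm, Finset.mul_sum, mul_assoc]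

theorem connectionTerm_eq_sum (x y : Fin 3 → ℝ) (k : Fin 3) :
    connectionTerm Γ x y k = ∑ j, y j * ∑ i, x i * Γ i j k := by
  rw [connectionTerm, Finset.sum_comm]
  refine Finset.sum_congr rfl fun j _ ↦ ?_
  rw [Finset.mul_sum]
  exact Finset.sum_congr rfl fun i _ ↦ by ring

/-- For fixed `x`, the map `y ↦ Γ(x, y)` is skew-symmetric, and skew-symmetric maps of `ℝ³` are
derivations of the cross product. -/
theorem connectionTerm_cross (hΓ : ∀ i j k, Γ i j k = -Γ i k j) (x y z : Fin 3 → ℝ) :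
    connectionTerm Γ x (y ⨯₃ z) = connectionTerm Γ x y ⨯₃ z + y ⨯₃ connectionTerm Γ x z := by
  have hs : ∀ j k, ∑ i, x i * Γ i j k = -∑ i, x i * Γ i k j := by
    intro j k
    rw [← Finset.sum_neg_distrib]
    exact Finset.sum_congr rfl fun i _ ↦ by rw [hΓ i j k]; ring
  set G : Fin 3 → Fin 3 → ℝ := fun j k ↦ ∑ i, x i * Γ i j k with hG
  have e (w : Fin 3 → ℝ) (k : Fin 3) : connectionTerm Γ x w k = ∑ j, w j * G j k :=
    connectionTerm_eq_sum x w k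
  have h0 : ∀ j, G j j = 0 := fun j ↦ by linarith [hs j j]
  have h10 : G 1 0 = -G 0 1 := hs 1 0
  have h20 : G 2 0 = -G 0 2 := hs 2 0
  have h21 : G 2 1 = -G 1 2 := hs 2 1
  ext k
  fin_cases k <;>
  · simp [cross_apply, e, Fin.sum_univ_three, h0, h10, h20, h21]
    ring

theorem connectionTerm_dotProduct (hΓ : ∀ i j k, Γ i j k = -Γ i k j) (x y z : Fin 3 → ℝ) :
    connectionTerm Γ x y ⬝ᵥ z + y ⬝ᵥ connectionTerm Γ x z = 0 := by
  simp only [dotProduct, connectionTerm_eq_sum, Finset.sum_mul, Finset.mul_sum]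
  nth_rewrite 2 [Finset.sum_comm]
  rw [← Finset.sum_add_distrib]
  refine Finset.sum_eq_zero fun k _ ↦ ?_
  rw [← Finset.sum_add_distrib]
  refine Finset.sum_eq_zero fun j _ ↦ ?_
  rw [← Finset.sum_add_distrib]
  refine Finset.sum_eq_zero fun i _ ↦ ?_
  rw [hΓ i j k]
  ring

variable {θ : Π p : S, TangentSpace 𝓘(ℝ, ℝ × ℝ) p →L[ℝ] (Fin 3 → ℝ)}

theorem frameDeriv_cross (hΓ : ∀ i j k, Γ i j k = -Γ i k j) {W₁ W₂ : S → Fin 3 → ℝ} {p : S}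
    (h₁ : MDifferentiableAt 𝓘(ℝ, ℝ × ℝ) 𝓘(ℝ, Fin 3 → ℝ) W₁ p)
    (h₂ : MDifferentiableAt 𝓘(ℝ, ℝ × ℝ) 𝓘(ℝ, Fin 3 → ℝ) W₂ p)
    (h : MDifferentiableAt 𝓘(ℝ, ℝ × ℝ) 𝓘(ℝ, Fin 3 → ℝ) (fun q ↦ W₁ q ⨯₃ W₂ q) p)
    (X : TangentSpace 𝓘(ℝ, ℝ × ℝ) p) :
    frameDeriv Γ θ (fun q ↦ W₁ q ⨯₃ W₂ q) p X =
      frameDeriv Γ θ W₁ p X ⨯₃ W₂ p + W₁ p ⨯₃ frameDeriv Γ θ W₂ p X := by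
  simp only [frameDeriv, mvfderiv_cross h₁ h₂ h, connectionTerm_cross hΓ, map_add,
    LinearMap.add_apply]
  abel

/-- Differentiate `N ⬝ᵥ N = 1`; the connection part drops out because it is skew. -/
theorem dotProduct_frameDeriv_eq_zero (hΓ : ∀ i j k, Γ i j k = -Γ i k j) {N : S → Fin 3 → ℝ}
    (hN : ∀ p, N p ⬝ᵥ N p = 1) {p : S}
    (h : MDifferentiableAt 𝓘(ℝ, ℝ × ℝ) 𝓘(ℝ, Fin 3 → ℝ) N p) (X : TangentSpace 𝓘(ℝ, ℝ × ℝ) p) :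
    N p ⬝ᵥ frameDeriv Γ θ N p X = 0 := by
  have h1 := mvfderiv_dotProduct h h X
  have h2 := connectionTerm_dotProduct hΓ (θ p X) (N p) (N p)
  simp only [hN] at h1
  rw [mvfderiv_const] at h1
  rw [frameDeriv, dotProduct_add]
  rw [dotProduct_comm (connectionTerm _ _ _)] at h2
  rw [dotProduct_comm (mvfderiv _ _ _ _)] at h1
  have h3 : (0 : ℝ) = N p ⬝ᵥ mvfderiv 𝓘(ℝ, ℝ × ℝ) N p X + N p ⬝ᵥ mvfderiv 𝓘(ℝ, ℝ × ℝ) N p X := h1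
  linarith

theorem frameDeriv_congr {W₁ W₂ : S → Fin 3 → ℝ} {p : S} (h : W₁ =ᶠ[𝓝 p] W₂)
    (X : TangentSpace 𝓘(ℝ, ℝ × ℝ) p) : frameDeriv Γ θ W₁ p X = frameDeriv Γ θ W₂ p X := by
  have h1 : mvfderiv 𝓘(ℝ, ℝ × ℝ) W₁ p X = mvfderiv 𝓘(ℝ, ℝ × ℝ) W₂ p X :=
    DFunLike.congr_fun h.mfderiv_eq X
  rw [frameDeriv, frameDeriv, h1, h.eq_of_nhds]

theorem frameDeriv_combination (N : S → Fin 3 → ℝ) (p : S) (x y : ℝ)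
    (X Y : TangentSpace 𝓘(ℝ, ℝ × ℝ) p) :
    frameDeriv Γ θ N p (x • X + y • Y) = x • frameDeriv Γ θ N p X + y • frameDeriv Γ θ N p Y := by
  simp only [frameDeriv, map_add, map_smul, connectionTerm_add_left, connectionTerm_smul_left]
  module

end Connection

section Christoffel

variable {E : Type*} [NormedAddCommGroup E] [NormedSpace ℝ E]
  {M : Type*} [TopologicalSpace M] [ChartedSpace E M] [Group M] [LieGroup 𝓘(ℝ, E) ∞ M]
  (g : LeftInvariantMetric E M) (b : Module.Basis (Fin 3) ℝ (GroupLieAlgebra 𝓘(ℝ, E) M))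

/-- Compatibility with the metric, in an orthonormal frame. -/
theorem christoffel_antisymm (i j k : Fin 3) : christoffel g b i j k = -christoffel g b i k j := by
  simp only [christoffel]
  linarith [structureConstant_swap g b i j k, structureConstant_swap g b j k i,
    structureConstant_swap g b k i j]

/-- Vanishing torsion, which later converts the bracket term of Maurer-Cartan into covariant
derivatives. -/
theorem christoffel_sub_swap (i j k : Fin 3) :
    christoffel g b i j k - christoffel g b j i k = structureConstant g b i j k := by
  simp only [christoffel]
  linarith [structureConstant_swap g b i j k, structureConstant_swap g b j k i,
    structureConstant_swap g b k i j]

end Christoffel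

end FrameDerivative

/-! ### The Maurer-Cartan equation for solutions of the null systems -/

section MaurerCartan

open Set Topology

variable {S : Type*} [TopologicalSpace S] [ChartedSpace (ℝ × ℝ) S]

/-- The vector field with constant components `k` in the chart `e`. -/
def coordField (e : OpenPartialHomeomorph S (ℝ × ℝ)) (k : ℝ × ℝ) (p : S) :
    TangentSpace 𝓘(ℝ, ℝ × ℝ) p :=
  VectorField.mpullback 𝓘(ℝ, ℝ × ℝ) 𝓘(ℝ, ℝ × ℝ) e (fun _ ↦ k) p

theorem coordField_eq_combination (e : OpenPartialHomeomorph S (ℝ × ℝ)) (k : ℝ × ℝ) (p : S) :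
    coordField e k p = k.1 • coordU e p + k.2 • coordV e p := by
  have hk : k = k.1 • ((1 : ℝ), (0 : ℝ)) + k.2 • ((0 : ℝ), (1 : ℝ)) := by simp
  refine (congrArg (mfderiv 𝓘(ℝ, ℝ × ℝ) 𝓘(ℝ, ℝ × ℝ) e p).inverse hk).trans ?_
  exact (map_add _ _ _).trans (congrArg₂ (· + ·) (map_smul _ _ _) (map_smul _ _ _))

theorem contDiff_connectionTerm (Γ : Fin 3 → Fin 3 → Fin 3 → ℝ) :
    ContDiff ℝ ∞ fun z : (Fin 3 → ℝ) × (Fin 3 → ℝ) ↦ connectionTerm Γ z.1 z.2 := by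
  rw [contDiff_pi]
  intro k
  simp only [connectionTerm]
  fun_prop

theorem contDiff_cross :
    ContDiff ℝ ∞ fun z : (Fin 3 → ℝ) × (Fin 3 → ℝ) ↦ z.1 ⨯₃ z.2 := by
  rw [contDiff_pi]
  intro k
  fin_cases k <;>
  · simp [cross_apply]
    fun_prop

theorem contMDiff_one_div_sqrt_neg {K : S → ℝ} (hK : ContMDiff 𝓘(ℝ, ℝ × ℝ) 𝓘(ℝ, ℝ) ∞ K)
    (hK_neg : ∀ p, K p < 0) :
    ContMDiff 𝓘(ℝ, ℝ × ℝ) 𝓘(ℝ, ℝ) ∞ fun p ↦ 1 / √(-K p) := by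
  intro p
  have h : ContDiffAt ℝ ∞ (fun x : ℝ ↦ 1 / √(-x)) (K p) := by
    have hp : -K p ≠ 0 := by linarith [hK_neg p]
    exact contDiffAt_const.div (contDiffAt_id.neg.sqrt hp)
      (Real.sqrt_ne_zero'.2 (by linarith [hK_neg p]))
  exact h.comp_contMDiffAt (hK p)

variable [IsManifold 𝓘(ℝ, ℝ × ℝ) ∞ S] {e : OpenPartialHomeomorph S (ℝ × ℝ)}
  {θ : Π p : S, TangentSpace 𝓘(ℝ, ℝ × ℝ) p →L[ℝ] (Fin 3 → ℝ)}

theorem exists_equiv_coordField (he : e ∈ atlas (ℝ × ℝ) S) {p : S} (hp : p ∈ e.source) :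
    ∃ A : TangentSpace 𝓘(ℝ, ℝ × ℝ) p ≃L[ℝ] ℝ × ℝ,
      mfderiv 𝓘(ℝ, ℝ × ℝ) 𝓘(ℝ, ℝ × ℝ) e p = (A : TangentSpace 𝓘(ℝ, ℝ × ℝ) p →L[ℝ] ℝ × ℝ) ∧
        ∀ k, coordField e k p = A.symm k := by
  obtain ⟨A, hA⟩ := mfderiv_isInvertible he hp
  refine ⟨A, hA.symm, fun k ↦ ?_⟩
  have h := congrArg ContinuousLinearMap.inverse hA
  rw [ContinuousLinearMap.inverse_equiv] at h
  exact (DFunLike.congr_fun h k).symm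

theorem mfderiv_symm_eq_coordField (he : e ∈ atlas (ℝ × ℝ) S) {s : ℝ × ℝ} (hs : s ∈ e.target)
    (k : ℝ × ℝ) :
    mfderiv 𝓘(ℝ, ℝ × ℝ) 𝓘(ℝ, ℝ × ℝ) e.symm s k = coordField e k (e.symm s) := by
  have : IsManifold 𝓘(ℝ, ℝ × ℝ) 1 S := .of_le (n := ∞) (by simp)
  have h := DFunLike.congr_fun
    ((mdifferentiable_of_mem_atlas (I := 𝓘(ℝ, ℝ × ℝ)) he).comp_symm_deriv hs) k
  obtain ⟨A, hA, hk⟩ := exists_equiv_coordField he (e.map_target hs)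
  rw [hk]
  refine A.eq_symm_apply.2 (Eq.trans ?_ h)
  exact (DFunLike.congr_fun hA _).symm

theorem coordForm_apply (he : e ∈ atlas (ℝ × ℝ) S) {s : ℝ × ℝ} (hs : s ∈ e.target) (k : ℝ × ℝ) :
    coordForm θ e s k = θ (e.symm s) (coordField e k (e.symm s)) := by
  rw [← mfderiv_symm_eq_coordField he hs]
  rfl

theorem fderiv_comp_symm {F : Type*} [NormedAddCommGroup F] [NormedSpace ℝ F]
    (he : e ∈ atlas (ℝ × ℝ) S) {s : ℝ × ℝ} (hs : s ∈ e.target) {W : S → F}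
    (hW : MDifferentiableAt 𝓘(ℝ, ℝ × ℝ) 𝓘(ℝ, F) W (e.symm s)) (k : ℝ × ℝ) :
    fderiv ℝ (W ∘ e.symm) s k = mvfderiv 𝓘(ℝ, ℝ × ℝ) W (e.symm s) (coordField e k (e.symm s)) := by
  have c1 : MDifferentiableAt 𝓘(ℝ, ℝ × ℝ) 𝓘(ℝ, ℝ × ℝ) e.symm s :=
    (contMDiffAt_symm_of_mem_maximalAtlas (n := ∞) (IsManifold.subset_maximalAtlas he)
      hs).mdifferentiableAt (by simp)
  rw [← mfderiv_symm_eq_coordField he hs, ← mfderiv_eq_fderiv]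
  exact mfderiv_comp_apply s hW c1 k

theorem contDiffOn_comp_symm {F : Type*} [NormedAddCommGroup F] [NormedSpace ℝ F]
    (he : e ∈ atlas (ℝ × ℝ) S) {W : S → F} (hW : ContMDiffOn 𝓘(ℝ, ℝ × ℝ) 𝓘(ℝ, F) ∞ W e.source) :
    ContDiffOn ℝ ∞ (W ∘ e.symm) e.target := by
  rw [← contMDiffOn_iff_contDiffOn]
  exact hW.comp (contMDiffOn_symm_of_mem_maximalAtlas (IsManifold.subset_maximalAtlas he))
    fun s hs ↦ e.map_target hs

theorem coordForm_eq (he : e ∈ atlas (ℝ × ℝ) S) {s : ℝ × ℝ} (hs : s ∈ e.target) :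
    coordForm θ e s =
      (ContinuousLinearMap.fst ℝ ℝ ℝ).smulRight (((fun p ↦ θ p (coordU e p)) ∘ e.symm) s) +
      (ContinuousLinearMap.snd ℝ ℝ ℝ).smulRight (((fun p ↦ θ p (coordV e p)) ∘ e.symm) s) := by
  refine ContinuousLinearMap.ext fun k ↦ ?_
  rw [coordForm_apply he hs, coordField_eq_combination, map_add, map_smul, map_smul]
  rfl

theorem contDiffOn_coordForm (he : e ∈ atlas (ℝ × ℝ) S)
    (hU : ContMDiffOn 𝓘(ℝ, ℝ × ℝ) 𝓘(ℝ, Fin 3 → ℝ) ∞ (fun p ↦ θ p (coordU e p)) e.source)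
    (hV : ContMDiffOn 𝓘(ℝ, ℝ × ℝ) 𝓘(ℝ, Fin 3 → ℝ) ∞ (fun p ↦ θ p (coordV e p)) e.source) :
    ContDiffOn ℝ ∞ (coordForm θ e) e.target :=
  ((contDiffOn_const.smulRight (contDiffOn_comp_symm he hU)).add
    (contDiffOn_const.smulRight (contDiffOn_comp_symm he hV))).congr fun _ hs ↦ coordForm_eq he hs

theorem contMDiffOn_mvfderiv_coordField {F : Type*} [NormedAddCommGroup F] [NormedSpace ℝ F]
    (he : e ∈ atlas (ℝ × ℝ) S) {W : S → F} (hW : ContMDiff 𝓘(ℝ, ℝ × ℝ) 𝓘(ℝ, F) ∞ W) (k : ℝ × ℝ) :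
    ContMDiffOn 𝓘(ℝ, ℝ × ℝ) 𝓘(ℝ, F) ∞
      (fun p ↦ mvfderiv 𝓘(ℝ, ℝ × ℝ) W p (coordField e k p)) e.source := by
  have h1 : ContDiffOn ℝ ∞ (fun s ↦ fderiv ℝ (W ∘ e.symm) s k) e.target :=
    ((contDiffOn_comp_symm he hW.contMDiffOn).fderiv_of_isOpen e.open_target (m := ∞)
      (by simp)).clm_apply contDiffOn_const
  have h2 := h1.contMDiffOn.comp
    (contMDiffOn_of_mem_maximalAtlas (n := ∞) (I := 𝓘(ℝ, ℝ × ℝ))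
      (IsManifold.subset_maximalAtlas he))
    fun p hp ↦ e.map_source hp
  refine h2.congr fun p hp ↦ ?_
  rw [Function.comp_apply, fderiv_comp_symm he (e.map_source hp)
    (hW.mdifferentiable (by simp) _), e.left_inv hp]

theorem contMDiffOn_frameDeriv_coordField (Γ : Fin 3 → Fin 3 → Fin 3 → ℝ)
    (he : e ∈ atlas (ℝ × ℝ) S) {N : S → Fin 3 → ℝ}
    (hN : ContMDiff 𝓘(ℝ, ℝ × ℝ) 𝓘(ℝ, Fin 3 → ℝ) ∞ N) {k : ℝ × ℝ}
    (hk : ContMDiffOn 𝓘(ℝ, ℝ × ℝ) 𝓘(ℝ, Fin 3 → ℝ) ∞ (fun p ↦ θ p (coordField e k p)) e.source) :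
    ContMDiffOn 𝓘(ℝ, ℝ × ℝ) 𝓘(ℝ, Fin 3 → ℝ) ∞
      (fun p ↦ frameDeriv Γ θ N p (coordField e k p)) e.source :=
  (contMDiffOn_mvfderiv_coordField he hN k).add fun p hp ↦
    ContDiff.comp_contMDiffWithinAt (contDiff_connectionTerm Γ)
      ((hk p hp).prodMk_space (hN.contMDiffOn p hp))

variable {Γ : Fin 3 → Fin 3 → Fin 3 → ℝ} {N : S → Fin 3 → ℝ} {K : S → ℝ}

/-- The one-form `θ` is torsion free: `D_v a = D_u A`. -/
theorem frameDeriv_swap (hΓ : ∀ i j k, Γ i j k = -Γ i k j) (he : e ∈ atlas (ℝ × ℝ) S)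
    (hN : ContMDiff 𝓘(ℝ, ℝ × ℝ) 𝓘(ℝ, Fin 3 → ℝ) ∞ N)
    (hK : ContMDiff 𝓘(ℝ, ℝ × ℝ) 𝓘(ℝ, ℝ) ∞ K) (hK_neg : ∀ p, K p < 0)
    (hU : ContMDiffOn 𝓘(ℝ, ℝ × ℝ) 𝓘(ℝ, Fin 3 → ℝ) ∞ (fun p ↦ θ p (coordU e p)) e.source)
    (hV : ContMDiffOn 𝓘(ℝ, ℝ × ℝ) 𝓘(ℝ, Fin 3 → ℝ) ∞ (fun p ↦ θ p (coordV e p)) e.source)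
    (hsys : ∀ p ∈ e.source, SolvesNullSystems Γ N K θ e p) {p : S} (hp : p ∈ e.source)
    (hint : ∃ c : ℝ, integrabilityVector Γ N K θ e p = c • N p) :
    frameDeriv Γ θ (fun q ↦ θ q (coordU e q)) p (coordV e p) =
      frameDeriv Γ θ (fun q ↦ θ q (coordV e q)) p (coordU e p) := by
  have hρ := contMDiff_one_div_sqrt_neg hK hK_neg
  set ρ : S → ℝ := fun p ↦ 1 / √(-K p) with hρd
  set DU : S → Fin 3 → ℝ := fun q ↦ ρ q • frameDeriv Γ θ N q (coordU e q) with hDU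
  set DV : S → Fin 3 → ℝ := fun q ↦ ρ q • frameDeriv Γ θ N q (coordV e q) with hDV
  have hnhds : e.source ∈ 𝓝 p := e.open_source.mem_nhds hp
  have sU : ContMDiffAt 𝓘(ℝ, ℝ × ℝ) 𝓘(ℝ, Fin 3 → ℝ) ∞ DU p :=
    (hρ p).smul ((contMDiffOn_frameDeriv_coordField Γ he hN hU).contMDiffAt hnhds)
  have sV : ContMDiffAt 𝓘(ℝ, ℝ × ℝ) 𝓘(ℝ, Fin 3 → ℝ) ∞ DV p :=
    (hρ p).smul ((contMDiffOn_frameDeriv_coordField Γ he hN hV).contMDiffAt hnhds)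
  have cross_smooth : ∀ W : S → Fin 3 → ℝ, ContMDiffAt 𝓘(ℝ, ℝ × ℝ) 𝓘(ℝ, Fin 3 → ℝ) ∞ W p →
      MDifferentiableAt 𝓘(ℝ, ℝ × ℝ) 𝓘(ℝ, Fin 3 → ℝ) (fun q ↦ N q ⨯₃ W q) p := fun W hW ↦
    (contDiff_cross.contDiffAt.comp_contMDiffAt ((hN p).prodMk_space hW)).mdifferentiableAt
      (by simp)
  have hNp : MDifferentiableAt 𝓘(ℝ, ℝ × ℝ) 𝓘(ℝ, Fin 3 → ℝ) N p := hN.mdifferentiable (by simp) p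
  have eU : (fun q ↦ θ q (coordU e q)) =ᶠ[𝓝 p] fun q ↦ N q ⨯₃ DU q := by
    filter_upwards [hnhds] with q hq
    rw [(hsys q hq).1, hDU]
    simp only [map_smul, hρd]
  have eV : (fun q ↦ θ q (coordV e q)) =ᶠ[𝓝 p] fun q ↦ N q ⨯₃ (-DV q) := by
    filter_upwards [hnhds] with q hq
    rw [(hsys q hq).2, hDV]
    simp only [map_smul, map_neg, hρd, neg_div, neg_smul]
  have nV : ∀ X, frameDeriv Γ θ (fun q ↦ -DV q) p X = -frameDeriv Γ θ DV p X := by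
    intro X
    have h1 : mvfderiv 𝓘(ℝ, ℝ × ℝ) (fun q ↦ -DV q) p X = -mvfderiv 𝓘(ℝ, ℝ × ℝ) DV p X := by
      rw [mvfderiv_fun_neg]
      rfl
    have h2 : connectionTerm Γ (θ p X) (-DV p) = -connectionTerm Γ (θ p X) (DV p) := by
      ext k
      simp [connectionTerm]
    rw [frameDeriv, frameDeriv, h1, h2, neg_add]
  -- Leibniz rule on both sides, for `a = N × DU` and `A = N × (-DV)` near `p`.
  rw [frameDeriv_congr eU, frameDeriv_congr eV,
    frameDeriv_cross hΓ hNp (sU.mdifferentiableAt (by simp)) (cross_smooth _ sU),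
    frameDeriv_cross hΓ hNp (sV.neg.mdifferentiableAt (by simp)) (cross_smooth _ sV.neg), nV]
  obtain ⟨c, hc⟩ := hint
  have hc' : frameDeriv Γ θ DV p (coordU e p) + frameDeriv Γ θ DU p (coordV e p) = c • N p := hc
  -- Integrability trades one second derivative for minus the other, up to a multiple of `N` that `N
  -- ×` kills. The first-order terms then match by anticommutativity.
  have h3 : frameDeriv Γ θ DU p (coordV e p) = c • N p - frameDeriv Γ θ DV p (coordU e p) :=
    eq_sub_of_add_eq' hc'
  have hNc : N p ⨯₃ (c • N p) = 0 := by rw [map_smul, cross_self, smul_zero]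
  have hpU : DU p = ρ p • frameDeriv Γ θ N p (coordU e p) := rfl
  have hpV : DV p = ρ p • frameDeriv Γ θ N p (coordV e p) := rfl
  rw [h3, map_sub, hNc, zero_sub, map_neg, map_neg, hpU, hpV]
  simp only [map_smul]
  rw [← smul_neg, cross_anticomm (frameDeriv Γ θ N p (coordU e p))]

variable {E : Type*} [NormedAddCommGroup E] [NormedSpace ℝ E]
  {M : Type*} [TopologicalSpace M] [ChartedSpace E M] [Group M] [LieGroup 𝓘(ℝ, E) ∞ M]
  {g : LeftInvariantMetric E M} {b : Module.Basis (Fin 3) ℝ (GroupLieAlgebra 𝓘(ℝ, E) M)}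

/-- The Maurer-Cartan defect is alternating in `(k, l)`, so in two dimensions it is a determinant
times its value on `∂_u`, `∂_v`. That value is the difference of the two covariant derivatives in
`hswap`, by vanishing torsion. -/
theorem maurerCartanOn_coordForm (he : e ∈ atlas (ℝ × ℝ) S)
    (hU : ContMDiffOn 𝓘(ℝ, ℝ × ℝ) 𝓘(ℝ, Fin 3 → ℝ) ∞ (fun p ↦ θ p (coordU e p)) e.source)
    (hV : ContMDiffOn 𝓘(ℝ, ℝ × ℝ) 𝓘(ℝ, Fin 3 → ℝ) ∞ (fun p ↦ θ p (coordV e p)) e.source)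
    (hswap : ∀ p ∈ e.source,
      frameDeriv (christoffel g b) θ (fun q ↦ θ q (coordU e q)) p (coordV e p) =
        frameDeriv (christoffel g b) θ (fun q ↦ θ q (coordV e q)) p (coordU e p)) :
    MaurerCartanOn (structureConstant g b) (coordForm θ e) e.target := by
  intro s hs k l m
  set p := e.symm s with hpd
  have hp : p ∈ e.source := e.map_target hs
  have hnhds : e.source ∈ 𝓝 p := e.open_source.mem_nhds hp
  set a : S → Fin 3 → ℝ := fun q ↦ θ q (coordU e q) with ha
  set A : S → Fin 3 → ℝ := fun q ↦ θ q (coordV e q) with hA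
  have da := ((hU.contMDiffAt hnhds).mdifferentiableAt (by simp))
  have dA := ((hV.contMDiffAt hnhds).mdifferentiableAt (by simp))
  have dca : DifferentiableAt ℝ (a ∘ e.symm) s :=
    ((contDiffOn_comp_symm he hU).contDiffAt (e.open_target.mem_nhds hs)).differentiableAt (by simp)
  have dcA : DifferentiableAt ℝ (A ∘ e.symm) s :=
    ((contDiffOn_comp_symm he hV).contDiffAt (e.open_target.mem_nhds hs)).differentiableAt (by simp)
  have happ : ∀ l, coordForm θ e s l = l.1 • a p + l.2 • A p := fun l ↦ by
    rw [coordForm_eq he hs]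
    rfl
  have hder : ∀ k l, fderiv ℝ (coordForm θ e) s k l =
      l.1 • (k.1 • mvfderiv 𝓘(ℝ, ℝ × ℝ) a p (coordU e p) +
        k.2 • mvfderiv 𝓘(ℝ, ℝ × ℝ) a p (coordV e p)) +
      l.2 • (k.1 • mvfderiv 𝓘(ℝ, ℝ × ℝ) A p (coordU e p) +
        k.2 • mvfderiv 𝓘(ℝ, ℝ × ℝ) A p (coordV e p)) := by
    intro k l
    have h1 : fderiv ℝ (fun s ↦ coordForm θ e s l) s k = fderiv ℝ (coordForm θ e) s k l := by
      have h := ((contDiffOn_coordForm he hU hV).contDiffAt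
        (e.open_target.mem_nhds hs)).differentiableAt (by simp)
      rw [fderiv_clm_apply h (differentiableAt_const l)]
      simp
    have h2 : (fun s ↦ coordForm θ e s l) =ᶠ[𝓝 s]
        fun s ↦ l.1 • (a ∘ e.symm) s + l.2 • (A ∘ e.symm) s := by
      filter_upwards [e.open_target.mem_nhds hs] with s' hs'
      rw [coordForm_eq he hs']
      rfl
    have h3 := ((dca.hasFDerivAt.const_smul l.1).add (dcA.hasFDerivAt.const_smul l.2)).fderiv
    rw [← h1, h2.fderiv_eq]
    refine (DFunLike.congr_fun h3 k).trans ?_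
    simp only [_root_.add_apply, _root_.smul_apply]
    rw [fderiv_comp_symm he hs da, fderiv_comp_symm he hs dA, coordField_eq_combination]
    simp only [map_add, map_smul]
    rfl
  have hsw := congrFun (hswap p hp) m
  simp only [frameDeriv, Pi.add_apply, connectionTerm] at hsw
  have hc : ∀ i j, structureConstant g b j i m =
      christoffel g b j i m - christoffel g b i j m := fun i j ↦
    (christoffel_sub_swap g b j i m).symm
  simp only [hder, happ, hc, Pi.add_apply, Pi.smul_apply, smul_eq_mul]
  simp only [Fin.sum_univ_three] at hsw ⊢
  linear_combination (l.1 * k.2 - l.2 * k.1) * hsw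

end MaurerCartan

/-! ### Null frames of a surface -/

section NullFrame

theorem eq_dotProduct_smul_of_cross_eq_zero {n w : Fin 3 → ℝ} (hn : n ⬝ᵥ n = 1)
    (h : n ⨯₃ w = 0) : w = (n ⬝ᵥ w) • n := by
  have h1 := cross_cross_eq_smul_sub_smul n w n
  rw [h, hn, one_smul, map_zero, LinearMap.zero_apply, dotProduct_comm w n] at h1
  exact sub_eq_zero.1 h1.symm

/-- On the plane orthogonal to `n`, `n ×` is a quarter turn with square `-1`. This inverts the null
systems, with `r = √-K` for `a` and `r = -√-K` for `A`. -/
theorem eq_cross_of_eq_smul_cross {n x P : Fin 3 → ℝ} {r : ℝ} (hr : r ≠ 0) (hn : n ⬝ᵥ n = 1)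
    (hP : n ⬝ᵥ P = 0) (hx : x = r⁻¹ • (n ⨯₃ P)) : P = -(r • (n ⨯₃ x)) := by
  have h1 := cross_cross_eq_smul_sub_smul n P n
  rw [hn, one_smul, dotProduct_comm P n, hP, zero_smul, sub_zero, ← cross_anticomm] at h1
  rw [hx, map_smul, smul_smul, mul_inv_cancel₀ hr, one_smul, h1]

theorem dotProduct_eq_zero_of_eq_smul_cross {n x P : Fin 3 → ℝ} {r : ℝ}
    (hx : x = r • (n ⨯₃ P)) : n ⬝ᵥ x = 0 := by
  rw [hx, dotProduct_smul, dot_self_cross, smul_zero]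

theorem cross_eq_smul_normal {n a A : Fin 3 → ℝ} (hn : n ⬝ᵥ n = 1) (ha : n ⬝ᵥ a = 0)
    (hA : n ⬝ᵥ A = 0) : a ⨯₃ A = (n ⬝ᵥ (a ⨯₃ A)) • n := by
  refine eq_dotProduct_smul_of_cross_eq_zero hn ?_
  rw [← cross_anticomm, cross_cross_eq_smul_sub_smul, dotProduct_comm a, dotProduct_comm A, ha, hA]
  simp

theorem dotProduct_cross_ne_zero {n a A : Fin 3 → ℝ} (hn : n ⬝ᵥ n = 1) (ha : n ⬝ᵥ a = 0)
    (hA : n ⬝ᵥ A = 0) (hli : LinearIndependent ℝ ![a, A]) : n ⬝ᵥ (a ⨯₃ A) ≠ 0 := by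
  intro h
  refine crossProduct_ne_zero_iff_linearIndependent.2 hli ?_
  rw [cross_eq_smul_normal hn ha hA, h, zero_smul]

/-- Lagrange's identity: the squared volume is the Gram determinant. -/
theorem sq_dotProduct_cross {n a A : Fin 3 → ℝ} (hn : n ⬝ᵥ n = 1) (ha : n ⬝ᵥ a = 0)
    (hA : n ⬝ᵥ A = 0) :
    (n ⬝ᵥ (a ⨯₃ A)) ^ 2 = (a ⬝ᵥ a) * (A ⬝ᵥ A) - (a ⬝ᵥ A) ^ 2 := by
  have h := cross_dot_cross a A a A
  rw [cross_eq_smul_normal hn ha hA, smul_dotProduct, dotProduct_smul, hn] at h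
  rw [dotProduct_comm A a] at h
  simp only [smul_eq_mul, mul_one] at h
  rw [sq, sq]
  exact h

/-- Expands the rotated vector `n × w` in `a` and `A`; the matrix of the shape operator is read off
from it. -/
theorem smul_normal_cross {n a A : Fin 3 → ℝ} (hn : n ⬝ᵥ n = 1) (ha : n ⬝ᵥ a = 0)
    (hA : n ⬝ᵥ A = 0) (w : Fin 3 → ℝ) :
    (n ⬝ᵥ (a ⨯₃ A)) • (n ⨯₃ w) = (a ⬝ᵥ w) • A - (A ⬝ᵥ w) • a := by
  rw [← cross_cross_eq_smul_sub_smul a A w]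
  conv_rhs => rw [cross_eq_smul_normal hn ha hA]
  rw [map_smul, LinearMap.smul_apply]

end NullFrame

/-! ### Geometry of a primitive of the one-form -/

section Realization

open Set Topology

variable {E : Type*} [NormedAddCommGroup E] [NormedSpace ℝ E]
  {M : Type*} [TopologicalSpace M] [ChartedSpace E M] [Group M]
  {S : Type*} [TopologicalSpace S] [ChartedSpace (ℝ × ℝ) S]
  {b : Module.Basis (Fin 3) ℝ (GroupLieAlgebra 𝓘(ℝ, E) M)}
  {θ : Π p : S, TangentSpace 𝓘(ℝ, ℝ × ℝ) p →L[ℝ] (Fin 3 → ℝ)} {φ : S → M}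

theorem leftFrame_eq_frameVector (i : Fin 3) (q : M) :
    leftFrame b i q = frameVector b (Pi.single i 1) q := by
  simp [frameVector, Pi.single_apply, Finset.sum_ite_eq']

variable [LieGroup 𝓘(ℝ, E) ∞ M] {g : LeftInvariantMetric E M}

/-- This turns the Levi-Civita derivative along `φ` into the algebraic derivative built from `θ`. -/
theorem IsPrimitiveAt.leftTranslatedDeriv_eq (hb : g.IsOrthonormal b) {p : S}
    (h : IsPrimitiveAt b θ φ p) : leftTranslatedDeriv g b φ p = θ p := by
  refine ContinuousLinearMap.ext fun X ↦ funext fun i ↦ ?_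
  change g.inner (φ p) (leftFrame b i (φ p)) (mfderiv 𝓘(ℝ, ℝ × ℝ) 𝓘(ℝ, E) φ p X) = θ p X i
  rw [h.2 X, leftFrame_eq_frameVector, g.inner_frameVector hb, single_one_dotProduct]

theorem IsPrimitiveAt.covDerivAlong_eq (hb : g.IsOrthonormal b) {p : S}
    (h : IsPrimitiveAt b θ φ p) (N : S → Fin 3 → ℝ) (X : TangentSpace 𝓘(ℝ, ℝ × ℝ) p) :
    covDerivAlong g b φ N p X = frameVector b (frameDeriv (christoffel g b) θ N p X) (φ p) := by
  rw [covDerivAlong, frameDeriv, h.leftTranslatedDeriv_eq hb, frameDeriv]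

theorem IsPrimitiveAt.secondFundamentalForm_eq (hb : g.IsOrthonormal b) {p : S}
    (h : IsPrimitiveAt b θ φ p) (N : S → Fin 3 → ℝ) (X Y : TangentSpace 𝓘(ℝ, ℝ × ℝ) p) :
    secondFundamentalForm g b φ N p X Y =
      -(frameDeriv (christoffel g b) θ N p X ⬝ᵥ θ p Y) := by
  rw [secondFundamentalForm, h.2 Y, h.covDerivAlong_eq hb, ← frameVector_neg,
    g.inner_frameVector hb, neg_dotProduct]

variable [IsManifold 𝓘(ℝ, ℝ × ℝ) ∞ S] {e : OpenPartialHomeomorph S (ℝ × ℝ)}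

theorem exists_linearMap_coordField (he : e ∈ atlas (ℝ × ℝ) S) {p : S} (hp : p ∈ e.source)
    (t : Matrix (Fin 2) (Fin 2) ℝ) :
    ∃ T : TangentSpace 𝓘(ℝ, ℝ × ℝ) p →ₗ[ℝ] TangentSpace 𝓘(ℝ, ℝ × ℝ) p,
      T (coordU e p) = t 0 0 • coordU e p + t 1 0 • coordV e p ∧
      T (coordV e p) = t 0 1 • coordU e p + t 1 1 • coordV e p ∧ LinearMap.det T = t.det := by
  obtain ⟨A, -, hA⟩ := exists_equiv_coordField he hp
  set T₀ := Matrix.toLin (Module.Basis.finTwoProd ℝ) (Module.Basis.finTwoProd ℝ) t with hT₀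
  have hk (k : ℝ × ℝ) : T₀ k = (t 0 0 * k.1 + t 0 1 * k.2, t 1 0 * k.1 + t 1 1 * k.2) := by
    rw [hT₀, t.eta_fin_two, Matrix.toLin_finTwoProd_apply]
    rfl
  set D := A.toLinearEquiv with hD
  have hT : ∀ k, ((D.symm : ℝ × ℝ →ₗ[ℝ] TangentSpace 𝓘(ℝ, ℝ × ℝ) p) ∘ₗ T₀ ∘ₗ
      (D : TangentSpace 𝓘(ℝ, ℝ × ℝ) p →ₗ[ℝ] ℝ × ℝ)) (coordField e k p) = coordField e (T₀ k) p := by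
    intro k
    rw [hA, hA]
    exact congrArg (fun z ↦ A.symm (T₀ z)) (A.apply_symm_apply k)
  refine ⟨_, (hT (1, 0)).trans ?_, (hT (0, 1)).trans ?_, ?_⟩
  · rw [coordField_eq_combination, hk]
    simp
  · rw [coordField_eq_combination, hk]
    simp
  · refine (LinearMap.det_conj T₀ D.symm).trans ?_
    rw [hT₀, LinearMap.det_toLin]

theorem exists_eq_combination_coord (he : e ∈ atlas (ℝ × ℝ) S) {p : S} (hp : p ∈ e.source)
    (X : TangentSpace 𝓘(ℝ, ℝ × ℝ) p) :
    ∃ x y : ℝ, X = x • coordU e p + y • coordV e p := by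
  obtain ⟨A, -, hA⟩ := exists_equiv_coordField he hp
  refine ⟨(A X).1, (A X).2, ?_⟩
  rw [← coordField_eq_combination, hA, A.symm_apply_apply]

/-- For uniqueness, only smoothness and the prescribed derivatives are needed. -/
theorem RealizesData.isPrimitiveAt {N : S → Fin 3 → ℝ} {K : S → ℝ}
    (h : RealizesData g b N K θ φ) (p : S) : IsPrimitiveAt b θ φ p := by
  refine ⟨h.immersion.1 p, fun X ↦ ?_⟩
  have he := chart_mem_atlas (ℝ × ℝ) p
  have hp := mem_chart_source (ℝ × ℝ) p
  obtain ⟨x, y, rfl⟩ := exists_eq_combination_coord he hp X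
  obtain ⟨h1, h2⟩ := h.deriv_eq _ he p hp
  simp only [map_add, map_smul, frameVector_add, frameVector_smul, h1, h2]

theorem realizesData_of_isPrimitiveAt (hb : g.IsOrthonormal b) {N : S → Fin 3 → ℝ}
    (hN : ContMDiff 𝓘(ℝ, ℝ × ℝ) 𝓘(ℝ, Fin 3 → ℝ) ∞ N) (hN_unit : ∀ p, N p ⬝ᵥ N p = 1)
    {K : S → ℝ} (hK_neg : ∀ p, K p < 0)
    (hθ_indep : ∀ e ∈ atlas (ℝ × ℝ) S, ∀ p ∈ e.source,
      LinearIndependent ℝ ![θ p (coordU e p), θ p (coordV e p)])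
    (h_systems : ∀ e ∈ atlas (ℝ × ℝ) S, ∀ p ∈ e.source,
      SolvesNullSystems (christoffel g b) N K θ e p)
    (hφ : ∀ p, IsPrimitiveAt b θ φ p) : RealizesData g b N K θ φ := by
  have hs : ∀ p, 0 < √(-K p) := fun p ↦ Real.sqrt_pos.2 (by linarith [hK_neg p])
  have hNX : ∀ p X, N p ⬝ᵥ frameDeriv (christoffel g b) θ N p X = 0 := fun p X ↦
    dotProduct_frameDeriv_eq_zero (christoffel_antisymm g b) hN_unit
      (hN.mdifferentiable (by simp) p) X
  have hna : ∀ e ∈ atlas (ℝ × ℝ) S, ∀ p ∈ e.source, N p ⬝ᵥ θ p (coordU e p) = 0 :=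
    fun e he p hp ↦ dotProduct_eq_zero_of_eq_smul_cross (h_systems e he p hp).1
  have hnA : ∀ e ∈ atlas (ℝ × ℝ) S, ∀ p ∈ e.source, N p ⬝ᵥ θ p (coordV e p) = 0 :=
    fun e he p hp ↦ dotProduct_eq_zero_of_eq_smul_cross (h_systems e he p hp).2
  -- The null systems solved for the derivatives of `N`; everything below is algebra in `N`, `a` and
  -- `A`.
  have hP : ∀ e ∈ atlas (ℝ × ℝ) S, ∀ p ∈ e.source,
      frameDeriv (christoffel g b) θ N p (coordU e p) =
        -(√(-K p) • (N p ⨯₃ θ p (coordU e p))) := fun e he p hp ↦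
    eq_cross_of_eq_smul_cross (hs p).ne' (hN_unit p) (hNX p _)
      (by rw [inv_eq_one_div]; exact (h_systems e he p hp).1)
  have hQ : ∀ e ∈ atlas (ℝ × ℝ) S, ∀ p ∈ e.source,
      frameDeriv (christoffel g b) θ N p (coordV e p) =
        √(-K p) • (N p ⨯₃ θ p (coordV e p)) := fun e he p hp ↦ by
    have h := eq_cross_of_eq_smul_cross (neg_ne_zero.2 (hs p).ne') (hN_unit p) (hNX p _)
      (x := θ p (coordV e p)) (by
        rw [inv_eq_one_div, one_div_neg_eq_neg_one_div, ← neg_div]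
        exact (h_systems e he p hp).2)
    rw [h, neg_smul, neg_neg]
  have hII : ∀ e ∈ atlas (ℝ × ℝ) S, ∀ p ∈ e.source,
      secondFundamentalForm g b φ N p (coordU e p) (coordV e p) =
        √(-K p) * (N p ⬝ᵥ (θ p (coordU e p) ⨯₃ θ p (coordV e p))) := fun e he p hp ↦ by
    rw [(hφ p).secondFundamentalForm_eq hb, hP e he p hp, neg_dotProduct, neg_neg, smul_dotProduct,
      smul_eq_mul, dotProduct_comm, triple_product_permutation, triple_product_permutation]
  have hd : ∀ e ∈ atlas (ℝ × ℝ) S, ∀ p ∈ e.source,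
      N p ⬝ᵥ (θ p (coordU e p) ⨯₃ θ p (coordV e p)) ≠ 0 := fun e he p hp ↦
    dotProduct_cross_ne_zero (hN_unit p) (hna e he p hp) (hnA e he p hp) (hθ_indep e he p hp)
  refine ⟨⟨fun p ↦ (hφ p).1, fun p ↦ ?_⟩, fun p ↦ ⟨?_, fun X ↦ ?_⟩, fun p ↦ ?_,
    fun e he p hp ↦ ⟨(hφ p).2 _, (hφ p).2 _⟩, fun e he p hp ↦ ⟨?_, ?_, ?_, ?_⟩,
    fun e he p hp ↦ ?_⟩
  · have he := chart_mem_atlas (ℝ × ℝ) p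
    have hp := mem_chart_source (ℝ × ℝ) p
    refine (injective_iff_map_eq_zero _).2 fun X hX ↦ ?_
    have h0 : θ p X = 0 := by
      refine g.frameVector_injective hb (φ p) ?_
      refine ((hφ p).2 X).symm.trans (hX.trans ?_)
      simp [frameVector]
    obtain ⟨x, y, rfl⟩ := exists_eq_combination_coord he hp X
    rw [map_add, map_smul, map_smul] at h0
    obtain ⟨rfl, rfl⟩ := LinearIndependent.pair_iff.1 (hθ_indep _ he p hp) x y h0
    simp
  · rw [g.inner_frameVector hb, hN_unit]
  · have he := chart_mem_atlas (ℝ × ℝ) p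
    have hp := mem_chart_source (ℝ × ℝ) p
    obtain ⟨x, y, rfl⟩ := exists_eq_combination_coord he hp X
    rw [(hφ p).2, g.inner_frameVector hb, map_add, map_smul, map_smul, dotProduct_add,
      dotProduct_smul, dotProduct_smul, hna _ he p hp, hnA _ he p hp]
    simp
  · have he := chart_mem_atlas (ℝ × ℝ) p
    have hp := mem_chart_source (ℝ × ℝ) p
    set e := chartAt (ℝ × ℝ) p
    have hd' := hd e he p hp
    have hsq := sq_dotProduct_cross (hN_unit p) (hna e he p hp) (hnA e he p hp)
    have hcr := smul_normal_cross (hN_unit p) (hna e he p hp) (hnA e he p hp)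
    have hP' := hP e he p hp
    have hQ' := hQ e he p hp
    set a := θ p (coordU e p) with ha
    set A := θ p (coordV e p) with hA
    set d := N p ⬝ᵥ (a ⨯₃ A) with hdd
    set r := √(-K p) / d with hr
    have hcr' : ∀ w, √(-K p) • (N p ⨯₃ w) = r • ((a ⬝ᵥ w) • A - (A ⬝ᵥ w) • a) := fun w ↦ by
      rw [← hcr, smul_smul, hr, div_mul_cancel₀ _ hd']
    -- The columns are the coordinates of `√-K N × a` and `-√-K N × A`, from `hcr'`. The determinant
    -- is `-r ^ 2` times the Gram determinant `d ^ 2`, hence `K`.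
    obtain ⟨T, hTU, hTV, hdet⟩ := exists_linearMap_coordField he hp
      !![-(r * (a ⬝ᵥ A)), r * (A ⬝ᵥ A); r * (a ⬝ᵥ a), -(r * (a ⬝ᵥ A))]
    refine ⟨T, fun X ↦ ?_, ?_⟩
    · rw [(hφ p).2, (hφ p).covDerivAlong_eq hb, ← frameVector_neg]
      congr 1
      obtain ⟨x, y, rfl⟩ := exists_eq_combination_coord he hp X
      rw [frameDeriv_combination, hP', hQ', hcr', hcr', map_add, map_smul, map_smul, hTU, hTV]
      simp only [map_add, map_smul, ← ha, ← hA, dotProduct_comm A a]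
      simp
      module
    · rw [hdet, det_fin_two_of]
      have h1 : √(-K p) ^ 2 = -K p := Real.sq_sqrt (by linarith [hK_neg p])
      have h2 : r ^ 2 * d ^ 2 = -K p := by
        rw [hr, div_pow, div_mul_cancel₀ _ (pow_ne_zero 2 hd'), h1]
      rw [hsq] at h2
      linarith
  · rw [(hφ p).secondFundamentalForm_eq hb, hP e he p hp, neg_dotProduct, neg_neg, smul_dotProduct,
      dotProduct_comm, dot_cross_self, smul_zero]
  · rw [(hφ p).secondFundamentalForm_eq hb, hQ e he p hp, smul_dotProduct,
      dotProduct_comm, dot_cross_self, smul_zero, neg_zero]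
  · rw [hII e he p hp, (hφ p).secondFundamentalForm_eq hb, hQ e he p hp, smul_dotProduct,
      smul_eq_mul, dotProduct_comm (N p ⨯₃ _), triple_product_permutation, ← cross_anticomm,
      dotProduct_neg]
    ring
  · rw [hII e he p hp]
    exact mul_ne_zero (hs p).ne' (hd e he p hp)
  · rw [hII e he p hp]
    exact mul_pos_iff_of_pos_left (hs p)

end Realization
end

theorem theorem4p2
    {E : Type*} [NormedAddCommGroup E] [NormedSpace ℝ E]
    {M : Type*} [TopologicalSpace M] [T2Space M] [ChartedSpace E M] [Group M]
    [LieGroup 𝓘(ℝ, E) ∞ M]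
    (g : LeftInvariantMetric E M)
    (b : Module.Basis (Fin 3) ℝ (GroupLieAlgebra 𝓘(ℝ, E) M)) (hb : g.IsOrthonormal b)
    {S : Type*} [TopologicalSpace S] [T2Space S] [ChartedSpace (ℝ × ℝ) S] [LorentzSurface S]
    [SimplyConnectedSpace S]
    (N : S → Fin 3 → ℝ) (hN : ContMDiff 𝓘(ℝ, ℝ × ℝ) 𝓘(ℝ, Fin 3 → ℝ) ∞ N)
    (hN_unit : ∀ p, N p ⬝ᵥ N p = 1)
    (K : S → ℝ) (hK : ContMDiff 𝓘(ℝ, ℝ × ℝ) 𝓘(ℝ, ℝ) ∞ K) (hK_neg : ∀ p, K p < 0)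
    (θ : Π p : S, TangentSpace 𝓘(ℝ, ℝ × ℝ) p →L[ℝ] (Fin 3 → ℝ))
    (hθ : ∀ e ∈ atlas (ℝ × ℝ) S,
      ContMDiffOn 𝓘(ℝ, ℝ × ℝ) 𝓘(ℝ, Fin 3 → ℝ) ∞ (fun p ↦ θ p (coordU e p)) e.source ∧
      ContMDiffOn 𝓘(ℝ, ℝ × ℝ) 𝓘(ℝ, Fin 3 → ℝ) ∞ (fun p ↦ θ p (coordV e p)) e.source)
    (hθ_indep : ∀ e ∈ atlas (ℝ × ℝ) S, ∀ p ∈ e.source,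
      LinearIndependent ℝ ![θ p (coordU e p), θ p (coordV e p)])
    (h_systems : ∀ e ∈ atlas (ℝ × ℝ) S, ∀ p ∈ e.source,
      SolvesNullSystems (christoffel g b) N K θ e p)
    (h_integrable : ∀ e ∈ atlas (ℝ × ℝ) S, ∀ p ∈ e.source,
      ∃ c : ℝ, integrabilityVector (christoffel g b) N K θ e p = c • N p) :
    ∃ φ : S → M, RealizesData g b N K θ φ ∧
      ∀ ψ : S → M, RealizesData g b N K θ ψ ↔ ∃ a : M, ∀ p, ψ p = a * φ p := by
  -- The Lie algebra is the tangent space at the identity, which is `E` by definition, so `b` is a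
  -- finite basis of `E`.
  have : FiniteDimensional ℝ E := Module.Finite.of_basis (M := E) b
  have : CompleteSpace E := FiniteDimensional.complete ℝ E
  have hη : ∀ e ∈ atlas (ℝ × ℝ) S, ContDiffOn ℝ ∞ (coordForm θ e) e.target := fun e he ↦
    contDiffOn_coordForm he (hθ e he).1 (hθ e he).2
  have hmc : ∀ e ∈ atlas (ℝ × ℝ) S,
      MaurerCartanOn (structureConstant g b) (coordForm θ e) e.target := fun e he ↦
    maurerCartanOn_coordForm he (hθ e he).1 (hθ e he).2 fun p hp ↦
      frameDeriv_swap (christoffel_antisymm g b) he hN hK hK_neg (hθ e he).1 (hθ e he).2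
        (h_systems e he) hp (h_integrable e he p hp)
  obtain ⟨φ, hφ⟩ := exists_forall_isPrimitiveAt g hb hη hmc
  have hreal (ψ : S → M) (hψ : ∀ p, IsPrimitiveAt b θ ψ p) : RealizesData g b N K θ ψ :=
    realizesData_of_isPrimitiveAt hb hN hN_unit hK_neg hθ_indep h_systems hψ
  refine ⟨φ, hreal φ hφ, fun ψ ↦ ⟨fun hψ ↦ ?_, ?_⟩⟩
  · exact exists_eq_mul_of_isPrimitiveAt hη hφ hψ.isPrimitiveAt
  · rintro ⟨a, ha⟩
    obtain rfl : ψ = fun p ↦ a * φ p := funext ha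
    exact hreal _ fun p ↦ (hφ p).mul_left a
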